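/- Let $\mu$ be a positive measure on $\mathbb R$ with infinite support and finite moments $s_n=\int x^n\,d\mu(x)$, $n\ge 0$, and assume that $\mu$ is indeterminate, i.e. there is a positive measure $\nu\ne\mu$ on $\mathbb R$ with the same moments. For $N\ge 0$ let $\mathcal H_N=(s_{j+k})_{j,k=0}^N$, let $\lambda_{N,0}\le\lambda_{N,1}\le\dots\le\lambda_{N,N}$ be its eigenvalues, counted with multiplicity, and put $\lambda_{\infty,n}=\lim_{N\to\infty}\lambda_{N,n}$. Let $(P_n)$ be the orthonormal polynomials of $\mu$ ($P_n$ has degree $n$ and positive leading coefficient, and $\int P_nP_m\,d\mu=\delta_{nm}$), and let $$K(z,w)=\sum_{n=0}^\infty P_n(z)P_n(w)=\sum_{j,k=0}^\infty a_{j,k}z^jw^k,\qquad z,w\in\mathbb C,$$ where the $a_{j,k}$ are the Taylor coefficients of $K$ at the origin. Then these objects are well defined: $\sum_n|P_n(z)|^2<\infty$ for all $z\in\mathbb C$, the displayed power series converges absolutely to $K(z,w)$ for all $z,w\in\mathbb C$, and for every $n\ge 0$ the limit $\lambda_{\infty,n}$ exists and is positive. Moreover, the infinite matrix $\mathcal A=(a_{j,k})_{j,k\ge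 0}$ is the matrix, in the standard basis, of a bounded operator $\mathcal A$ on the complex Hilbert space $\ell^2$. This operator is of trace class and positive (that is, self-adjoint with $\langle \mathcal Ax,x\rangle\ge 0$ for all $x\in\ell^2$), and its spectrum is $$\sigma(\mathcal A)=\{0\}\cup\{\lambda_{\infty,n}^{-1}\mid n=0,1,2,\dots\}.$$ -/

import Mathlib

open MeasureTheory Filter Topology Polynomial

/-! ### Moments and (in)determinacy -/

/-- All moments of `μ` exist (absolutely). The case `n = 0` says that `μ` is finite. -/
def HasFiniteMoments (μ : Measure ℝ) : Prop :=
  ∀ n : ℕ, Integrable (fun x : ℝ => x ^ n) μ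

/-- The moments `s n = ∫ x ^ n dμ(x)`. -/
noncomputable def moment (μ : Measure ℝ) (n : ℕ) : ℝ := ∫ x, x ^ n ∂μ

/-- `μ` is indeterminate: there is another positive measure on `ℝ` with the same moments. -/
def IsIndeterminate (μ : Measure ℝ) : Prop :=
  ∃ ν : Measure ℝ, ν ≠ μ ∧ HasFiniteMoments ν ∧ ∀ n : ℕ, moment ν n = moment μ n

/-! ### Hankel matrices and their eigenvalues -/

/-- The Hankel matrix `(s (i + j))` with `0 ≤ i, j ≤ N`. -/
noncomputable def hankel (μ : Measure ℝ) (N : ℕ) : Matrix (Fin (N + 1)) (Fin (N + 1)) ℝ :=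
  Matrix.of fun i j => moment μ ((i : ℕ) + (j : ℕ))

theorem hankel_isHermitian (μ : Measure ℝ) (N : ℕ) : (hankel μ N).IsHermitian := by
  ext i j
  simp [hankel, Matrix.conjTranspose_apply, add_comm]

/-- For `n ≤ N`, the `n`-th smallest eigenvalue (`n = 0, …, N`, counted with multiplicity) of the
Hankel matrix of order `N + 1`. Mathlib lists the eigenvalues in decreasing order, so that
it is the entry number `N - n` of that list. (The value for `n > N` is irrelevant.) -/
noncomputable def hankelEigenvalue (μ : Measure ℝ) (N n : ℕ) : ℝ :=
  (hankel_isHermitian μ N).eigenvalues₀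
    ⟨N - n, by rw [Fintype.card_fin]; omega⟩

/-- `lim_{N → ∞}` of the `n`-th smallest eigenvalue of the Hankel matrix of order `N + 1`. -/
noncomputable def limitEigenvalue (μ : Measure ℝ) (n : ℕ) : ℝ :=
  limUnder atTop (fun N : ℕ => hankelEigenvalue μ N n)

/-! ### Orthonormal polynomials -/

/-- The inner product `∫ p q dμ` of two real polynomials. -/
noncomputable def polyInner (μ : Measure ℝ) (p q : ℝ[X]) : ℝ :=
  ∫ x, p.eval x * q.eval x ∂μ

/-- The monic orthogonal polynomials of `μ`, by the Gram–Schmidt process on `1, x, x², …`. -/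
noncomputable def monicOrthPoly (μ : Measure ℝ) : ℕ → ℝ[X]
  | n => X ^ n - ∑ k : Fin n,
      C (polyInner μ (X ^ n) (monicOrthPoly μ k) /
        polyInner μ (monicOrthPoly μ k) (monicOrthPoly μ k)) * monicOrthPoly μ k

/-- The orthonormal polynomials `P n` of `μ`. -/
noncomputable def orthPoly (μ : Measure ℝ) (n : ℕ) : ℝ[X] :=
  C (Real.sqrt (polyInner μ (monicOrthPoly μ n) (monicOrthPoly μ n)))⁻¹ * monicOrthPoly μ n

section OrthonormalPolynomials

theorem integrable_poly {μ : Measure ℝ} (hμ : HasFiniteMoments μ) (p : ℝ[X]) :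
    Integrable (fun x => p.eval x) μ := by
  simp only [Polynomial.eval_eq_sum_range]
  exact integrable_finsetSum _ fun i _ => (hμ i).const_mul _

theorem polyInner_comm (μ : Measure ℝ) (p q : ℝ[X]) : polyInner μ p q = polyInner μ q p := by
  simp only [polyInner, mul_comm]

theorem polyInner_C_mul_left (μ : Measure ℝ) (c : ℝ) (p q : ℝ[X]) :
    polyInner μ (C c * p) q = c * polyInner μ p q := by
  simp only [polyInner, eval_mul, eval_C, mul_assoc]
  exact integral_const_mul _ _

theorem polyInner_sub_left {μ : Measure ℝ} (hμ : HasFiniteMoments μ) (p q r : ℝ[X]) :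
    polyInner μ (p - q) r = polyInner μ p r - polyInner μ q r := by
  simp only [polyInner, eval_sub, sub_mul]
  refine integral_sub ?_ ?_
  · simpa using integrable_poly hμ (p * r)
  · simpa using integrable_poly hμ (q * r)

theorem polyInner_sum_left {μ : Measure ℝ} (hμ : HasFiniteMoments μ) {ι : Type*} (s : Finset ι)
    (f : ι → ℝ[X]) (r : ℝ[X]) :
    polyInner μ (∑ i ∈ s, f i) r = ∑ i ∈ s, polyInner μ (f i) r := by
  simp only [polyInner, eval_finsetSum, Finset.sum_mul]
  refine integral_finsetSum _ fun i _ => ?_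
  simpa using integrable_poly hμ (f i * r)

theorem polyInner_self_pos {μ : Measure ℝ} (hμ : HasFiniteMoments μ)
    (hsupp : μ.support.Infinite) {p : ℝ[X]} (hp : p ≠ 0) : 0 < polyInner μ p p := by
  have hnn : 0 ≤ polyInner μ p p := integral_nonneg fun x => mul_self_nonneg _
  refine lt_of_le_of_ne hnn fun h0 => hsupp ?_
  have hae : (fun x => p.eval x * p.eval x) =ᵐ[μ] 0 :=
    (integral_eq_zero_iff_of_nonneg (fun x => mul_self_nonneg _)
      (by simpa using integrable_poly hμ (p * p))).1 h0.symm
  have hfin : {x : ℝ | p.eval x = 0}.Finite := by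
    refine (p.roots.toFinset.finite_toSet).subset fun x hx => ?_
    simpa [hp] using hx
  refine hfin.subset (Measure.support_subset_of_isClosed hfin.isClosed ?_)
  filter_upwards [hae] with x hx
  simpa using hx

theorem monicOrthPoly_eq (μ : Measure ℝ) (n : ℕ) :
    monicOrthPoly μ n = X ^ n - ∑ k : Fin n,
      C (polyInner μ (X ^ n) (monicOrthPoly μ k) /
        polyInner μ (monicOrthPoly μ k) (monicOrthPoly μ k)) * monicOrthPoly μ k := by
  conv_lhs => rw [monicOrthPoly]

theorem monicOrthPoly_monic_natDegree (μ : Measure ℝ) (n : ℕ) :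
    (monicOrthPoly μ n).Monic ∧ (monicOrthPoly μ n).natDegree = n := by
  induction n using Nat.strong_induction_on with
  | _ n ih =>
    have hlt : (∑ k : Fin n,
      C (polyInner μ (X ^ n) (monicOrthPoly μ k) /
        polyInner μ (monicOrthPoly μ k) (monicOrthPoly μ k)) * monicOrthPoly μ k).degree
          < (n : WithBot ℕ) := by
      refine (Polynomial.degree_sum_le _ _).trans_lt ?_
      refine (Finset.sup_lt_iff (WithBot.bot_lt_coe n)).2 fun k _ => ?_
      refine (degree_mul_le _ _).trans_lt ((add_le_of_nonpos_left degree_C_le).trans_lt ?_)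
      rw [Polynomial.degree_eq_natDegree (ih k k.2).1.ne_zero, (ih k k.2).2]
      exact Nat.cast_lt.2 k.2
    rw [monicOrthPoly_eq]
    refine ⟨(monic_X_pow n).sub_of_left (by simpa using hlt), ?_⟩
    refine natDegree_eq_of_degree_eq_some ?_
    rw [degree_sub_eq_left_of_degree_lt (by simpa using hlt), degree_X_pow]

theorem monicOrthPoly_orth {μ : Measure ℝ} (hμ : HasFiniteMoments μ)
    (hsupp : μ.support.Infinite) (n : ℕ) :
    ∀ m < n, polyInner μ (monicOrthPoly μ n) (monicOrthPoly μ m) = 0 := by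
  induction n using Nat.strong_induction_on with
  | _ n ih =>
    intro m hm
    have hpos := polyInner_self_pos hμ hsupp (monicOrthPoly_monic_natDegree μ m).1.ne_zero
    rw [monicOrthPoly_eq, polyInner_sub_left hμ, polyInner_sum_left hμ,
      Finset.sum_eq_single (⟨m, hm⟩ : Fin n), polyInner_C_mul_left]
    · field_simp
      simp
    · intro k _ hk
      rw [polyInner_C_mul_left]
      have hne : (k : ℕ) ≠ m := fun h => hk (Fin.ext h)
      rcases lt_or_gt_of_ne hne with h | h
      · rw [polyInner_comm μ (monicOrthPoly μ k) (monicOrthPoly μ m), ih m hm k h, mul_zero]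
      · rw [ih k k.2 m h, mul_zero]
    · simp

/-- `P n` is the sequence of orthonormal polynomials of `μ`: `P n` has degree `n` and positive
leading coefficient, and `∫ P n P m dμ = δ n m`. -/
theorem orthPoly_spec {μ : Measure ℝ} (hμ : HasFiniteMoments μ) (hsupp : μ.support.Infinite) :
    (∀ n, (orthPoly μ n).natDegree = n ∧ 0 < (orthPoly μ n).leadingCoeff) ∧
    ∀ n m, ∫ x, (orthPoly μ n).eval x * (orthPoly μ m).eval x ∂μ = if n = m then 1 else 0 := by
  have hpos n := polyInner_self_pos hμ hsupp (monicOrthPoly_monic_natDegree μ n).1.ne_zero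
  have hs n := Real.sqrt_pos.2 (hpos n)
  refine ⟨fun n => ⟨?_, ?_⟩, fun n m => ?_⟩
  · rw [orthPoly, natDegree_C_mul (inv_ne_zero (hs n).ne'),
      (monicOrthPoly_monic_natDegree μ n).2]
  · rw [orthPoly, leadingCoeff_mul, leadingCoeff_C,
      (monicOrthPoly_monic_natDegree μ n).1.leadingCoeff, mul_one]
    exact inv_pos.2 (hs n)
  · change polyInner μ (orthPoly μ n) (orthPoly μ m) = _
    rw [orthPoly, orthPoly, polyInner_C_mul_left, polyInner_comm μ (monicOrthPoly μ n) (C _ * _),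
      polyInner_C_mul_left]
    rcases lt_trichotomy n m with h | h | h
    · rw [monicOrthPoly_orth hμ hsupp m n h]; simp [h.ne]
    · subst h
      have hq := Real.mul_self_sqrt (hpos n).le
      have hn := (hs n).ne'
      rw [if_pos rfl]
      nth_rewrite 3 [← hq]
      field_simp
    · rw [polyInner_comm μ (monicOrthPoly μ m) (monicOrthPoly μ n),
        monicOrthPoly_orth hμ hsupp n m h]
      simp [h.ne']

end OrthonormalPolynomials

/-! ### The kernel and its coefficients -/

/-- `K(z, w) = ∑ P n (z) P n (w)` for complex `z` and `w`. -/
noncomputable def kernelK (μ : Measure ℝ) (z w : ℂ) : ℂ :=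
  ∑' n : ℕ, aeval z (orthPoly μ n) * aeval w (orthPoly μ n)

/-- The Taylor coefficient of `z ^ j * w ^ k` at the origin of the function `K(z, w)`. -/
noncomputable def kernelCoeff (μ : Measure ℝ) (j k : ℕ) : ℂ :=
  iteratedDeriv j (fun z : ℂ => iteratedDeriv k (fun w : ℂ => kernelK μ z w) 0) 0 /
    ((j.factorial : ℂ) * (k.factorial : ℂ))

/-! ### Operators on Hilbert spaces -/

/-- A bounded operator `T` on a complex Hilbert space is of trace class: `∑ ⟨|T| e i, e i⟩ < ∞`
for every orthonormal basis `e`, where `|T| = (T* T)^(1/2)`. -/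
def IsTraceClass {H : Type} [NormedAddCommGroup H] [InnerProductSpace ℂ H] [CompleteSpace H]
    (T : H →L[ℂ] H) : Prop :=
  ∀ (ι : Type) (e : HilbertBasis ι ℂ H),
    Summable fun i : ι => (inner ℂ (CFC.abs T (e i)) (e i)).re

/-- The complex Hilbert space `ℓ²` of square summable sequences indexed by `0, 1, 2, …`. -/
abbrev EllTwo : Type := lp (fun _ : ℕ => ℂ) 2

/-- The bounded operator `T` on `ℓ²` has the infinite matrix `a` in the standard basis: the `k`-th
column of `a` is the image of the `k`-th standard basis vector. -/
def HasMatrix (T : EllTwo →L[ℂ] EllTwo) (a : ℕ → ℕ → ℂ) : Prop :=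
  ∀ j k : ℕ, T (lp.single 2 k (1 : ℂ)) j = a j k

/-! ### Finite measures are determined by their Stieltjes transforms -/

/-! Let `b n` in `ℓ²` be the coefficient vector of `P n`. Formally `a j k = ∑ n, b n j * b n k`, so
`𝒜` should be the sum of the rank one operators `⟨b n, ·⟩ b n`. Everything rests on strong
summability of these vectors: for every `R ≥ 0` the numbers `∑ j, |b n j| R ^ j` are square summable
in `n` (`summable_weightedNorm_sq`).

To get this, let `ν ≠ μ` have the same moments. Their Stieltjes transforms differ at some non-real
`z` (`ext_of_stieltjes`), and this forces `∑ |P n (z)|² < ∞` at that `z`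
(`exists_summable_norm_sq`); Bessel's inequality gives the same for the polynomials of the second
kind. Expanding `(P n - P n (z)) / (X - z)` in `P 0, …, P (n - 1)` yields a Volterra recursion with
square summable kernel (`cOrthPoly_eq_add_sum`), and a Gronwall argument in the weighted norm
finishes. Absolute convergence of the power series of `K`, positivity, compactness and the trace
class property follow.

For the spectrum, the sum of the first `N + 1` rank one operators acts on the first `N + 1`
coordinates as the inverse of the Hankel matrix, so its eigenvalues there are the `1 / λ_{N,n}`. The
trace bounds `(n + 1) / λ_{N,n}` by a constant `K` uniformly in `N`; with interlacing, this gives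
positive limits. Norm convergence of the truncations puts the limits in the spectrum, and the
uniform decay `K / (n + 1)` excludes any other nonzero point (`spectrum_frameOp`). -/

theorem norm_inv_ofReal_sub_le (x : ℝ) {z : ℂ} (hz : z.im ≠ 0) :
    ‖((x : ℂ) - z)⁻¹‖ ≤ |z.im|⁻¹ := by
  rw [norm_inv]
  refine inv_anti₀ (abs_pos.2 hz) ?_
  simpa using Complex.abs_im_le_norm ((x : ℂ) - z)

theorem continuous_inv_ofReal_sub {z : ℂ} (hz : z.im ≠ 0) :
    Continuous fun x : ℝ => ((x : ℂ) - z)⁻¹ := by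
  refine Continuous.inv₀ (by fun_prop) fun x h => hz ?_
  have := congrArg Complex.im h
  simpa using this

theorem integrable_inv_ofReal_sub (μ : Measure ℝ) [IsFiniteMeasure μ] {z : ℂ} (hz : z.im ≠ 0) :
    Integrable (fun x : ℝ => ((x : ℂ) - z)⁻¹) μ :=
  Integrable.of_bound (continuous_inv_ofReal_sub hz).aestronglyMeasurable _
    (ae_of_all _ fun x => norm_inv_ofReal_sub_le x hz)

theorem im_inv_ofReal_sub (x a b : ℝ) :
    (((x : ℂ) - (a + b * Complex.I))⁻¹).im = b / ((x - a) ^ 2 + b ^ 2) := by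
  rw [Complex.inv_im, Complex.normSq_apply]
  simp
  ring

theorem integral_cauchy_kernel (f : ℝ → ℝ) (x : ℝ) {b : ℝ} (hb : 0 < b) :
    ∫ a, f a * (b / ((x - a) ^ 2 + b ^ 2)) = ∫ y, f (x + b * y) * (1 + y ^ 2)⁻¹ := by
  have h1 := integral_add_left_eq_self (μ := volume)
    (fun a => f a * (b / ((x - a) ^ 2 + b ^ 2))) x
  have h2 := Measure.integral_comp_mul_left
    (fun y => f (x + y) * (b / ((x - (x + y)) ^ 2 + b ^ 2))) b
  rw [← h1]
  rw [abs_of_pos (inv_pos.2 hb), smul_eq_mul] at h2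
  rw [← mul_right_inj' (inv_pos.2 hb).ne', ← h2, ← integral_const_mul]
  refine integral_congr_ae (ae_of_all _ fun y => ?_)
  have : (1 + y ^ 2) ≠ 0 := by positivity
  have : b ^ 2 * y ^ 2 + b ^ 2 ≠ 0 := by positivity
  simp only
  field_simp
  ring

/-- Justifies Fubini below: the Poisson kernel has mass `π` in `a` for each `x`, `f` is bounded and
`μ` is finite. -/
theorem integrable_cauchy_kernel (f : BoundedContinuousFunction ℝ ℝ) (μ : Measure ℝ)
    [IsFiniteMeasure μ] {b : ℝ} (hb : 0 < b) :
    Integrable (fun p : ℝ × ℝ => f p.2 * (b / ((p.1 - p.2) ^ 2 + b ^ 2))) (μ.prod volume) := by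
  have hcont : Continuous fun p : ℝ × ℝ => f p.2 * (b / ((p.1 - p.2) ^ 2 + b ^ 2)) := by
    refine (f.continuous.comp continuous_snd).mul (Continuous.div (by fun_prop) (by fun_prop) ?_)
    intro p; positivity
  have hk (x : ℝ) : Integrable (fun a : ℝ => b / ((x - a) ^ 2 + b ^ 2)) := by
    have h := ((integrable_inv_one_add_sq.comp_div hb.ne').comp_sub_left x).const_mul b⁻¹
    refine h.congr (ae_of_all _ fun a => ?_)
    have : (x - a) ^ 2 + b ^ 2 ≠ 0 := by positivity
    have : b ^ 2 + (x - a) ^ 2 ≠ 0 := by positivity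
    simp only
    field_simp
    ring
  rw [integrable_prod_iff hcont.aestronglyMeasurable]
  constructor
  · refine ae_of_all _ fun x => ?_
    exact (hk x).bdd_mul (c := ‖f‖) f.continuous.aestronglyMeasurable
      (ae_of_all _ fun a => f.norm_coe_le_norm a)
  · refine Integrable.of_bound (C := ‖f‖ * Real.pi) ?_ (ae_of_all _ fun x => ?_)
    · exact hcont.norm.aestronglyMeasurable.integral_prod_right'
    · have h1 : ∫ a, b / ((x - a) ^ 2 + b ^ 2) = Real.pi := by
        have := integral_cauchy_kernel (fun _ => 1) x hb
        simpa [integral_univ_inv_one_add_sq] using this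
      rw [Real.norm_of_nonneg (integral_nonneg fun _ => norm_nonneg _), ← h1,
        ← integral_const_mul]
      refine integral_mono_of_nonneg (ae_of_all _ fun _ => norm_nonneg _)
        ((hk x).const_mul _) (ae_of_all _ fun a => ?_)
      simp only [norm_mul]
      have : 0 ≤ b / ((x - a) ^ 2 + b ^ 2) := by positivity
      rw [Real.norm_of_nonneg this]
      exact mul_le_mul_of_nonneg_right (f.norm_coe_le_norm a) this

/-- The imaginary part of `1 / (x - (a + b i))` is the Poisson kernel, so by Fubini the Poisson
smoothing of `f`, integrated against `μ`, depends on `μ` only through its Stieltjes transform. -/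
theorem integral_poisson_eq (f : BoundedContinuousFunction ℝ ℝ) (μ : Measure ℝ)
    [IsFiniteMeasure μ] {b : ℝ} (hb : 0 < b) :
    ∫ x, (∫ y, f (x + b * y) * (1 + y ^ 2)⁻¹) ∂μ =
      ∫ a, f a * (∫ x, ((x : ℂ) - (a + b * Complex.I))⁻¹ ∂μ).im := by
  simp_rw [← integral_cauchy_kernel f _ hb]
  rw [integral_integral_swap (integrable_cauchy_kernel f μ hb)]
  refine integral_congr_ae (ae_of_all _ fun a => ?_)
  have hz : ((a : ℂ) + b * Complex.I).im ≠ 0 := by simpa using hb.ne'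
  simp only
  rw [integral_const_mul]
  congr 1
  have := integral_im (integrable_inv_ofReal_sub μ hz)
  simp only [RCLike.im_to_complex] at this
  rw [← this]
  simp_rw [im_inv_ofReal_sub]

/-- Approximate identity: dominated convergence is used in `y`, then in `x`. The kernel is not
normalised, whence the factor `π`. -/
theorem tendsto_integral_poisson (f : BoundedContinuousFunction ℝ ℝ) (μ : Measure ℝ)
    [IsFiniteMeasure μ] :
    Tendsto (fun n : ℕ => ∫ x, (∫ y, f (x + (1 / ((n : ℝ) + 1)) * y) * (1 + y ^ 2)⁻¹) ∂μ) atTop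
      (𝓝 (∫ x, f x * Real.pi ∂μ)) := by
  have hlim : Tendsto (fun n : ℕ => 1 / ((n : ℝ) + 1)) atTop (𝓝 0) :=
    tendsto_one_div_add_atTop_nhds_zero_nat
  have hbd (b x y : ℝ) : ‖f (x + b * y) * (1 + y ^ 2)⁻¹‖ ≤ ‖f‖ * (1 + y ^ 2)⁻¹ := by
    rw [norm_mul, Real.norm_of_nonneg (by positivity : (0 : ℝ) ≤ (1 + y ^ 2)⁻¹)]
    exact mul_le_mul_of_nonneg_right (f.norm_coe_le_norm _) (by positivity)
  have hc (b : ℝ) : Continuous fun p : ℝ × ℝ => f (p.1 + b * p.2) * (1 + p.2 ^ 2)⁻¹ := by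
    refine (f.continuous.comp (by fun_prop)).mul (Continuous.inv₀ (by fun_prop) ?_)
    intro p; positivity
  refine tendsto_integral_of_dominated_convergence (fun _ => ‖f‖ * Real.pi) ?_ ?_ ?_ ?_
  · intro n
    exact (hc _).aestronglyMeasurable.integral_prod_right' (ν := volume)
  · exact integrable_const _
  · intro n
    refine ae_of_all _ fun x => (norm_integral_le_integral_norm _).trans ?_
    rw [← integral_univ_inv_one_add_sq, ← integral_const_mul]
    exact integral_mono_of_nonneg (ae_of_all _ fun _ => norm_nonneg _)
      (integrable_inv_one_add_sq.const_mul _) (ae_of_all _ fun y => hbd _ _ _)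
  · refine ae_of_all _ fun x => ?_
    rw [← integral_univ_inv_one_add_sq, ← integral_const_mul]
    refine tendsto_integral_of_dominated_convergence (fun y => ‖f‖ * (1 + y ^ 2)⁻¹) ?_
      (integrable_inv_one_add_sq.const_mul _) (fun n => ae_of_all _ fun y => hbd _ _ _) ?_
    · intro n
      exact ((hc _).comp (Continuous.prodMk_right x)).aestronglyMeasurable
    · refine ae_of_all _ fun y => Tendsto.mul_const _ ?_
      have : Tendsto (fun n : ℕ => x + 1 / ((n : ℝ) + 1) * y) atTop (𝓝 (x + 0 * y)) :=
        (hlim.mul_const y).const_add x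
      rw [zero_mul, add_zero] at this
      exact (f.continuous.tendsto x).comp this

theorem ext_of_stieltjes (μ ν : Measure ℝ) [IsFiniteMeasure μ] [IsFiniteMeasure ν]
    (h : ∀ z : ℂ, z.im ≠ 0 → ∫ x : ℝ, ((x : ℂ) - z)⁻¹ ∂μ = ∫ x : ℝ, ((x : ℂ) - z)⁻¹ ∂ν) :
    μ = ν := by
  refine ext_of_forall_integral_eq_of_IsFiniteMeasure fun f => ?_
  have hμ := tendsto_integral_poisson f μ
  have hν := tendsto_integral_poisson f ν
  have heq : ∀ n : ℕ, ∫ x, (∫ y, f (x + (1 / ((n : ℝ) + 1)) * y) * (1 + y ^ 2)⁻¹) ∂μ =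
      ∫ x, (∫ y, f (x + (1 / ((n : ℝ) + 1)) * y) * (1 + y ^ 2)⁻¹) ∂ν := by
    intro n
    have hb : 0 < 1 / ((n : ℝ) + 1) := by positivity
    generalize 1 / ((n : ℝ) + 1) = b at hb ⊢
    rw [integral_poisson_eq f μ hb, integral_poisson_eq f ν hb]
    refine integral_congr_ae (ae_of_all _ fun a => ?_)
    simp only
    rw [h _ (by simpa using hb.ne')]
  simp_rw [heq] at hμ
  have := tendsto_nhds_unique hμ hν
  rw [integral_mul_const, integral_mul_const] at this
  exact mul_right_cancel₀ Real.pi_ne_zero this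

/-! ### A discrete Gronwall inequality -/

theorem summable_of_le_add_mul_sum {u a b : ℕ → ℝ} (hu : ∀ n, 0 ≤ u n) (ha : ∀ n, 0 ≤ a n)
    (hb : ∀ n, 0 ≤ b n) (hsa : Summable a) (hsb : Summable b)
    (h : ∀ n, u n ≤ a n + b n * ∑ k ∈ Finset.range n, u k) : Summable u := by
  -- The recursion multiplies the partial sum by `1 + b n ≤ exp (b n)` and adds `a n`; the
  -- exponentials collect into `exp (∑ b)`.
  have key : ∀ n, ∑ k ∈ Finset.range n, u k ≤
      (∑ k ∈ Finset.range n, a k) * Real.exp (∑ k ∈ Finset.range n, b k) := by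
    intro n
    induction n with
    | zero => simp
    | succ n ih =>
      rw [Finset.sum_range_succ, Finset.sum_range_succ, Finset.sum_range_succ, Real.exp_add]
      have h1 : 1 + b n ≤ Real.exp (b n) := by
        have := Real.add_one_le_exp (b n); linarith
      have h2 : 1 ≤ Real.exp (∑ k ∈ Finset.range n, b k) :=
        Real.one_le_exp (Finset.sum_nonneg fun k _ => hb k)
      have h3 : 1 ≤ Real.exp (b n) := Real.one_le_exp (hb n)
      set E := Real.exp (∑ k ∈ Finset.range n, b k)
      set e := Real.exp (b n)
      set S := ∑ k ∈ Finset.range n, u k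
      set T := ∑ k ∈ Finset.range n, a k
      have hS : 0 ≤ S := Finset.sum_nonneg fun k _ => hu k
      have h4 : S * (1 + b n) ≤ T * E * e := by
        refine mul_le_mul ih h1 (by linarith [hb n]) (hS.trans ih)
      have h5 : a n ≤ a n * (E * e) :=
        le_mul_of_one_le_right (ha n) (one_le_mul_of_one_le_of_one_le h2 h3)
      have := h n
      nlinarith
  refine summable_of_sum_range_le (c := (∑' k, a k) * Real.exp (∑' k, b k)) hu fun n => ?_
  refine (key n).trans ?_
  refine mul_le_mul (hsa.sum_le_tsum _ fun k _ => ha k) (Real.exp_le_exp.2 ?_)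
    (Real.exp_pos _).le (tsum_nonneg ha)
  exact hsb.sum_le_tsum _ fun k _ => hb k

/-! ### Integrals of complex polynomials -/

/-- The orthonormal polynomials with complex coefficients. -/
noncomputable def cOrthPoly (μ : Measure ℝ) (n : ℕ) : ℂ[X] :=
  (orthPoly μ n).map (algebraMap ℝ ℂ)

/-- The integral of a complex polynomial over the real line. -/
noncomputable def polyIntegral (μ : Measure ℝ) (p : ℂ[X]) : ℂ :=
  ∫ x : ℝ, p.eval (x : ℂ) ∂μ

theorem HasFiniteMoments.isFiniteMeasure {μ : Measure ℝ} (hμ : HasFiniteMoments μ) :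
    IsFiniteMeasure μ := by
  have h := hμ 0
  simpa [integrable_const_iff] using h

theorem integrable_ofReal_pow {μ : Measure ℝ} (hμ : HasFiniteMoments μ) (n : ℕ) :
    Integrable (fun x : ℝ => (x : ℂ) ^ n) μ := by
  have := (hμ n).ofReal (𝕜 := ℂ)
  simpa using this

theorem integrable_cpoly {μ : Measure ℝ} (hμ : HasFiniteMoments μ) (p : ℂ[X]) :
    Integrable (fun x : ℝ => p.eval (x : ℂ)) μ := by
  simp only [Polynomial.eval_eq_sum_range]
  exact integrable_finsetSum _ fun i _ => (integrable_ofReal_pow hμ i).const_mul _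

theorem polyIntegral_eq_sum {μ : Measure ℝ} (hμ : HasFiniteMoments μ) (p : ℂ[X]) :
    polyIntegral μ p = ∑ i ∈ Finset.range (p.natDegree + 1), p.coeff i * (moment μ i : ℂ) := by
  simp only [polyIntegral, Polynomial.eval_eq_sum_range]
  rw [integral_finsetSum _ fun i _ => (integrable_ofReal_pow hμ i).const_mul _]
  refine Finset.sum_congr rfl fun i _ => ?_
  rw [integral_const_mul, moment, ← integral_complex_ofReal]
  simp

theorem polyIntegral_congr {μ ν : Measure ℝ} (hμ : HasFiniteMoments μ) (hν : HasFiniteMoments ν)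
    (h : ∀ n, moment ν n = moment μ n) (p : ℂ[X]) : polyIntegral ν p = polyIntegral μ p := by
  simp only [polyIntegral_eq_sum hμ, polyIntegral_eq_sum hν, h]

theorem polyIntegral_add {μ : Measure ℝ} (hμ : HasFiniteMoments μ) (p q : ℂ[X]) :
    polyIntegral μ (p + q) = polyIntegral μ p + polyIntegral μ q := by
  simp only [polyIntegral, eval_add]
  exact integral_add (integrable_cpoly hμ p) (integrable_cpoly hμ q)

theorem polyIntegral_sub {μ : Measure ℝ} (hμ : HasFiniteMoments μ) (p q : ℂ[X]) :
    polyIntegral μ (p - q) = polyIntegral μ p - polyIntegral μ q := by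
  simp only [polyIntegral, eval_sub]
  exact integral_sub (integrable_cpoly hμ p) (integrable_cpoly hμ q)

theorem polyIntegral_C_mul (μ : Measure ℝ) (c : ℂ) (p : ℂ[X]) :
    polyIntegral μ (C c * p) = c * polyIntegral μ p := by
  simp only [polyIntegral, eval_mul, eval_C]
  exact integral_const_mul _ _

theorem polyIntegral_sum {μ : Measure ℝ} (hμ : HasFiniteMoments μ) {ι : Type*} (s : Finset ι)
    (f : ι → ℂ[X]) : polyIntegral μ (∑ i ∈ s, f i) = ∑ i ∈ s, polyIntegral μ (f i) := by
  simp only [polyIntegral, eval_finsetSum]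
  exact integral_finsetSum _ fun i _ => integrable_cpoly hμ (f i)

theorem eval_cOrthPoly (μ : Measure ℝ) (n : ℕ) (z : ℂ) :
    (cOrthPoly μ n).eval z = aeval z (orthPoly μ n) :=
  eval_map_algebraMap _ _

theorem eval_cOrthPoly_ofReal (μ : Measure ℝ) (n : ℕ) (x : ℝ) :
    (cOrthPoly μ n).eval (x : ℂ) = (((orthPoly μ n).eval x : ℝ) : ℂ) := by
  rw [eval_cOrthPoly]
  exact aeval_algebraMap_apply_eq_algebraMap_eval x _

theorem polyIntegral_cOrthPoly_mul {μ : Measure ℝ} (hμ : HasFiniteMoments μ)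
    (hsupp : μ.support.Infinite) (n m : ℕ) :
    polyIntegral μ (cOrthPoly μ n * cOrthPoly μ m) = if n = m then 1 else 0 := by
  simp only [polyIntegral, eval_mul, eval_cOrthPoly_ofReal]
  have := (orthPoly_spec hμ hsupp).2 n m
  simp_rw [← Complex.ofReal_mul]
  rw [integral_complex_ofReal, this]
  split_ifs <;> simp

theorem natDegree_cOrthPoly {μ : Measure ℝ} (hμ : HasFiniteMoments μ)
    (hsupp : μ.support.Infinite) (n : ℕ) : (cOrthPoly μ n).natDegree = n := by
  rw [cOrthPoly, natDegree_map, ((orthPoly_spec hμ hsupp).1 n).1]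

theorem exists_eq_sum_cOrthPoly {μ : Measure ℝ} (hμ : HasFiniteMoments μ)
    (hsupp : μ.support.Infinite) (n : ℕ) (p : ℂ[X]) (hp : p.degree < n) :
    ∃ a : ℕ → ℂ, p = ∑ k ∈ Finset.range n, C (a k) * cOrthPoly μ k := by
  induction n generalizing p with
  | zero =>
    refine ⟨0, ?_⟩
    have : p = 0 := by
      rw [← degree_eq_bot]
      simpa using hp
    simp [this]
  | succ n ih =>
    have hdeg := natDegree_cOrthPoly hμ hsupp n
    have hne : (cOrthPoly μ n).coeff n ≠ 0 := by
      have := ((orthPoly_spec hμ hsupp).1 n)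
      have h2 := this.2.ne'
      rw [leadingCoeff, this.1] at h2
      simpa [cOrthPoly, coeff_map] using h2
    set c := p.coeff n / (cOrthPoly μ n).coeff n
    obtain ⟨a, ha⟩ := ih (p - C c * cOrthPoly μ n) (by
      rw [degree_lt_iff_coeff_zero]
      intro m hm
      rcases hm.eq_or_lt with rfl | hm
      · simp [c, hne]
      · rw [coeff_sub, coeff_C_mul,
          coeff_eq_zero_of_natDegree_lt (by omega : (cOrthPoly μ n).natDegree < m), mul_zero,
          sub_zero]
        exact (degree_lt_iff_coeff_zero _ _).1 hp m hm)
    refine ⟨Function.update a n c, ?_⟩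
    rw [Finset.sum_range_succ, Function.update_self, ← sub_eq_iff_eq_add, ha]
    refine Finset.sum_congr rfl fun k hk => ?_
    rw [Function.update_of_ne (Finset.mem_range.1 hk).ne]

theorem polyIntegral_sum_mul_cOrthPoly {μ : Measure ℝ} (hμ : HasFiniteMoments μ)
    (hsupp : μ.support.Infinite) (n : ℕ) (a : ℕ → ℂ) (m : ℕ) :
    polyIntegral μ ((∑ k ∈ Finset.range n, C (a k) * cOrthPoly μ k) * cOrthPoly μ m) =
      if m < n then a m else 0 := by
  rw [Finset.sum_mul, polyIntegral_sum hμ]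
  simp_rw [mul_assoc, polyIntegral_C_mul, polyIntegral_cOrthPoly_mul hμ hsupp]
  simp

theorem eq_sum_polyIntegral {μ : Measure ℝ} (hμ : HasFiniteMoments μ)
    (hsupp : μ.support.Infinite) (n : ℕ) (p : ℂ[X]) (hp : p.degree < n) :
    p = ∑ k ∈ Finset.range n, C (polyIntegral μ (p * cOrthPoly μ k)) * cOrthPoly μ k := by
  obtain ⟨a, ha⟩ := exists_eq_sum_cOrthPoly hμ hsupp n p hp
  conv_lhs => rw [ha]
  refine Finset.sum_congr rfl fun k hk => ?_
  rw [ha, polyIntegral_sum_mul_cOrthPoly hμ hsupp, if_pos (Finset.mem_range.1 hk)]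

theorem polyIntegral_mul_cOrthPoly_eq_zero {μ : Measure ℝ} (hμ : HasFiniteMoments μ)
    (hsupp : μ.support.Infinite) (n : ℕ) (p : ℂ[X]) (hp : p.degree < n) :
    polyIntegral μ (p * cOrthPoly μ n) = 0 := by
  obtain ⟨a, ha⟩ := exists_eq_sum_cOrthPoly hμ hsupp n p hp
  rw [ha, polyIntegral_sum_mul_cOrthPoly hμ hsupp, if_neg (lt_irrefl n)]

theorem norm_sq_eval_sum (μ : Measure ℝ) (N : ℕ) (c : ℕ → ℂ) (x : ℝ) :
    ((‖(∑ k ∈ Finset.range N, C (c k) * cOrthPoly μ k).eval (x : ℂ)‖ ^ 2 : ℝ) : ℂ) =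
      ((∑ k ∈ Finset.range N, C (c k) * cOrthPoly μ k) *
        ∑ k ∈ Finset.range N, C (starRingEnd ℂ (c k)) * cOrthPoly μ k).eval (x : ℂ) := by
  rw [eval_mul, Complex.ofReal_pow, ← Complex.mul_conj']
  congr 1
  simp [eval_finsetSum, eval_cOrthPoly_ofReal]

theorem integrable_norm_sq_cpoly {μ : Measure ℝ} (hμ : HasFiniteMoments μ) (p : ℂ[X]) :
    Integrable (fun x : ℝ => ‖p.eval (x : ℂ)‖ ^ 2) μ := by
  have h := (integrable_cpoly hμ (p * p)).norm
  refine h.congr (ae_of_all _ fun x => ?_)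
  simp [sq]

/-- Parseval for `μ`, valid for `ν` too because on the real line the integrand is a polynomial and
only moments enter. -/
theorem integral_norm_sq_sum {μ ν : Measure ℝ} (hμ : HasFiniteMoments μ)
    (hsupp : μ.support.Infinite) (hν : HasFiniteMoments ν) (h : ∀ n, moment ν n = moment μ n)
    (N : ℕ) (c : ℕ → ℂ) :
    ∫ x : ℝ, ‖(∑ k ∈ Finset.range N, C (c k) * cOrthPoly μ k).eval (x : ℂ)‖ ^ 2 ∂ν =
      ∑ k ∈ Finset.range N, ‖c k‖ ^ 2 := by
  rw [← Complex.ofReal_inj, ← integral_complex_ofReal]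
  simp_rw [norm_sq_eval_sum]
  change polyIntegral ν _ = _
  rw [polyIntegral_congr hμ hν h, Finset.mul_sum, polyIntegral_sum hμ]
  simp_rw [mul_left_comm _ (C (starRingEnd ℂ _)), polyIntegral_C_mul,
    polyIntegral_sum_mul_cOrthPoly hμ hsupp]
  rw [Complex.ofReal_sum]
  refine Finset.sum_congr rfl fun k hk => ?_
  rw [if_pos (Finset.mem_range.1 hk), Complex.ofReal_pow, Complex.conj_mul']

theorem integrable_cpoly_mul_inv {μ : Measure ℝ} (hμ : HasFiniteMoments μ) (p : ℂ[X])
    {z : ℂ} (hz : z.im ≠ 0) :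
    Integrable (fun x : ℝ => p.eval (x : ℂ) * ((x : ℂ) - z)⁻¹) μ :=
  (integrable_cpoly hμ p).mul_bdd (c := |z.im|⁻¹) (continuous_inv_ofReal_sub hz).aestronglyMeasurable
    (ae_of_all _ fun x => norm_inv_ofReal_sub_le x hz)

/-- A Cauchy–Schwarz bound in the form `y ≤ (t + y² / t) / 2`, with `t` left free to be optimised by
the caller. -/
theorem norm_integral_sum_mul_inv_le {μ ν : Measure ℝ} (hμ : HasFiniteMoments μ)
    (hsupp : μ.support.Infinite) (hν : HasFiniteMoments ν) (h : ∀ n, moment ν n = moment μ n)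
    (N : ℕ) (c : ℕ → ℂ) {z : ℂ} (hz : z.im ≠ 0) {t : ℝ} (ht : 0 < t) :
    ‖∫ x : ℝ, (∑ k ∈ Finset.range N, C (c k) * cOrthPoly μ k).eval (x : ℂ) *
        ((x : ℂ) - z)⁻¹ ∂ν‖ ≤
      |z.im|⁻¹ * ((t * moment μ 0 + (∑ k ∈ Finset.range N, ‖c k‖ ^ 2) / t) / 2) := by
  have hfin := hν.isFiniteMeasure
  set g := ∑ k ∈ Finset.range N, C (c k) * cOrthPoly μ k
  have hint : Integrable (fun x : ℝ => (t + ‖g.eval (x : ℂ)‖ ^ 2 / t) / 2) ν :=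
    ((integrable_const t).add ((integrable_norm_sq_cpoly hν g).div_const t)).div_const 2
  have hval : ∫ x : ℝ, (t + ‖g.eval (x : ℂ)‖ ^ 2 / t) / 2 ∂ν =
      (t * moment μ 0 + (∑ k ∈ Finset.range N, ‖c k‖ ^ 2) / t) / 2 := by
    rw [integral_div, integral_add (integrable_const t)
      ((integrable_norm_sq_cpoly hν g).div_const t), integral_div,
      integral_norm_sq_sum hμ hsupp hν h, ← h 0]
    simp [moment, mul_comm]
  rw [← hval, ← integral_const_mul]
  refine (norm_integral_le_integral_norm _).trans (integral_mono_of_nonneg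
    (ae_of_all _ fun _ => norm_nonneg _) (hint.const_mul _) (ae_of_all _ fun x => ?_))
  simp only
  rw [norm_mul, mul_comm]
  refine mul_le_mul (norm_inv_ofReal_sub_le x hz) ?_ (norm_nonneg _) (by positivity)
  set y := ‖g.eval (x : ℂ)‖
  have : (t + y ^ 2 / t) / 2 - y = (t - y) ^ 2 / (2 * t) := by field_simp; ring
  have h2 : 0 ≤ (t - y) ^ 2 / (2 * t) := by positivity
  linarith

theorem eq_C_add_mul_divByMonic (p : ℂ[X]) (z : ℂ) :
    p = C (p.eval z) + (X - C z) * (p /ₘ (X - C z)) := by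
  have := modByMonic_add_div p (X - C z)
  rw [modByMonic_X_sub_C_eq_C_eval] at this
  exact this.symm

/-- Splits off the divided difference `(p x - p z) / (x - z)`: it is a polynomial in `x`, so its
integral is the same for all measures with the given moments. -/
theorem integral_mul_inv_eq {μ : Measure ℝ} (hμ : HasFiniteMoments μ) (p : ℂ[X])
    {z : ℂ} (hz : z.im ≠ 0) :
    ∫ x : ℝ, p.eval (x : ℂ) * ((x : ℂ) - z)⁻¹ ∂μ =
      polyIntegral μ (p /ₘ (X - C z)) + p.eval z * ∫ x : ℝ, ((x : ℂ) - z)⁻¹ ∂μ := by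
  have := hμ.isFiniteMeasure
  rw [polyIntegral, ← integral_const_mul, ← integral_add (integrable_cpoly hμ _)
    ((integrable_inv_ofReal_sub μ hz).const_mul _)]
  refine integral_congr_ae (ae_of_all _ fun x => ?_)
  have hne : (x : ℂ) - z ≠ 0 := fun h0 => hz (by simpa using congrArg Complex.im h0)
  simp only
  conv_lhs => rw [eq_C_add_mul_divByMonic p z]
  simp only [eval_add, eval_mul, eval_sub, eval_X, eval_C]
  field_simp
  ring

/-- Bessel's inequality for `x ↦ 1 / (x - z)`. Testing with the conjugate coefficients and `t =
|z.im|⁻¹` gives `S ≤ (t² s₀ + S) / 2` for the sum `S` on the left. -/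
theorem sum_norm_sq_integral_le {μ : Measure ℝ} (hμ : HasFiniteMoments μ)
    (hsupp : μ.support.Infinite) {z : ℂ} (hz : z.im ≠ 0) (N : ℕ) :
    ∑ k ∈ Finset.range N, ‖∫ x : ℝ, (cOrthPoly μ k).eval (x : ℂ) * ((x : ℂ) - z)⁻¹ ∂μ‖ ^ 2 ≤
      |z.im|⁻¹ ^ 2 * moment μ 0 := by
  set c : ℕ → ℂ := fun k => ∫ x : ℝ, (cOrthPoly μ k).eval (x : ℂ) * ((x : ℂ) - z)⁻¹ ∂μ
  have ht : 0 < |z.im|⁻¹ := inv_pos.2 (abs_pos.2 hz)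
  have h := norm_integral_sum_mul_inv_le hμ hsupp hμ (fun _ => rfl) N
    (fun k => starRingEnd ℂ (c k)) hz ht
  have heq : ∫ x : ℝ, (∑ k ∈ Finset.range N, C (starRingEnd ℂ (c k)) * cOrthPoly μ k).eval (x : ℂ)
      * ((x : ℂ) - z)⁻¹ ∂μ = ((∑ k ∈ Finset.range N, ‖c k‖ ^ 2 : ℝ) : ℂ) := by
    simp only [eval_finsetSum, Finset.sum_mul, eval_mul, eval_C, mul_assoc]
    rw [integral_finsetSum _ fun k _ => (integrable_cpoly_mul_inv hμ _ hz).const_mul _,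
      Complex.ofReal_sum]
    refine Finset.sum_congr rfl fun k _ => ?_
    rw [integral_const_mul, Complex.ofReal_pow, ← Complex.conj_mul']
  rw [heq, Complex.norm_real, Real.norm_of_nonneg (by positivity)] at h
  simp only [RCLike.norm_conj] at h
  have : |z.im|⁻¹ * ((|z.im|⁻¹ * moment μ 0 + (∑ k ∈ Finset.range N, ‖c k‖ ^ 2) / |z.im|⁻¹) / 2)
      = (|z.im|⁻¹ ^ 2 * moment μ 0 + ∑ k ∈ Finset.range N, ‖c k‖ ^ 2) / 2 := by
    field_simp
  rw [this] at h
  linarith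

theorem exists_stieltjes_ne {μ : Measure ℝ} (hμ : HasFiniteMoments μ) {ν : Measure ℝ}
    (hν : HasFiniteMoments ν) (hne : ν ≠ μ) :
    ∃ z : ℂ, z.im ≠ 0 ∧ ∫ x : ℝ, ((x : ℂ) - z)⁻¹ ∂ν ≠ ∫ x : ℝ, ((x : ℂ) - z)⁻¹ ∂μ := by
  by_contra! hcon
  have := hμ.isFiniteMeasure
  have := hν.isFiniteMeasure
  exact hne (ext_of_stieltjes ν μ hcon)

/-- Take `g = ∑ conj (P k (z)) P k`, so that `g z = κ` and `g` has square norm `κ` for both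
measures. In the difference of `∫ g / (x - z)` for `ν` and `μ` the divided differences cancel and `κ
D` remains, while each integral is `O(√κ)`. Hence `κ` is bounded independently of `N`. -/
theorem exists_summable_norm_sq {μ : Measure ℝ} (hμ : HasFiniteMoments μ)
    (hsupp : μ.support.Infinite) (hindet : IsIndeterminate μ) :
    ∃ z : ℂ, z.im ≠ 0 ∧ Summable fun n => ‖(cOrthPoly μ n).eval z‖ ^ 2 := by
  obtain ⟨ν, hne, hν, hmo⟩ := hindet
  obtain ⟨z, hz, hD⟩ := exists_stieltjes_ne hμ hν hne
  refine ⟨z, hz, ?_⟩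
  set D := ∫ x : ℝ, ((x : ℂ) - z)⁻¹ ∂ν - ∫ x : ℝ, ((x : ℂ) - z)⁻¹ ∂μ with hDdef
  have hDpos : 0 < ‖D‖ := norm_pos_iff.2 (sub_ne_zero.2 hD)
  refine summable_of_sum_range_le (c := (|z.im|⁻¹ * (moment μ 0 + 1) / ‖D‖) ^ 2)
    (fun n => by positivity) fun N => ?_
  set κ := ∑ k ∈ Finset.range N, ‖(cOrthPoly μ k).eval z‖ ^ 2 with hκ
  have hκ0 : 0 ≤ κ := Finset.sum_nonneg fun _ _ => by positivity
  rcases hκ0.eq_or_lt with h0 | hpos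
  · rw [← h0]; positivity
  set c : ℕ → ℂ := fun k => starRingEnd ℂ ((cOrthPoly μ k).eval z)
  set g := ∑ k ∈ Finset.range N, C (c k) * cOrthPoly μ k with hg
  have hgz : g.eval z = κ := by
    simp only [hg, eval_finsetSum, eval_mul, eval_C, c, hκ, Complex.ofReal_sum,
      Complex.ofReal_pow, Complex.conj_mul']
  have hS : ∑ k ∈ Finset.range N, ‖c k‖ ^ 2 = κ := by simp [c, hκ]
  have hs : 0 < √κ := Real.sqrt_pos.2 hpos
  -- With `t = √κ` both terms of the bound are of order `√κ`.
  have h1 := norm_integral_sum_mul_inv_le hμ hsupp hμ (fun _ => rfl) N c hz hs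
  have h2 := norm_integral_sum_mul_inv_le hμ hsupp hν hmo N c hz hs
  rw [← hg, integral_mul_inv_eq hμ _ hz, hS, hgz] at h1
  rw [← hg, integral_mul_inv_eq hν _ hz, hS, hgz, polyIntegral_congr hμ hν hmo] at h2
  have h3 := (norm_sub_le _ _).trans (add_le_add h2 h1)
  rw [add_sub_add_left_eq_sub, ← mul_sub, norm_mul, Complex.norm_real, Real.norm_of_nonneg hκ0,
    ← hDdef, Real.div_sqrt] at h3
  rw [← Real.sq_sqrt hκ0]
  refine pow_le_pow_left₀ hs.le ?_ 2
  rw [le_div_iff₀ hDpos]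
  have h4 : √κ * (√κ * ‖D‖) ≤ √κ * (|z.im|⁻¹ * (moment μ 0 + 1)) := by
    rw [← mul_assoc, Real.mul_self_sqrt hκ0]
    linarith
  exact le_of_mul_le_mul_left h4 hs

/-! ### The expansion of the orthonormal polynomials at a non-real point -/

/-- The value at `z` of the polynomials of the second kind. -/
noncomputable def secondKind (μ : Measure ℝ) (z : ℂ) (n : ℕ) : ℂ :=
  polyIntegral μ (cOrthPoly μ n /ₘ (X - C z))

theorem summable_norm_sq_secondKind {μ : Measure ℝ} (hμ : HasFiniteMoments μ)
    (hsupp : μ.support.Infinite) {z : ℂ} (hz : z.im ≠ 0)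
    (hP : Summable fun n => ‖(cOrthPoly μ n).eval z‖ ^ 2) :
    Summable fun n => ‖secondKind μ z n‖ ^ 2 := by
  set F := ∫ x : ℝ, ((x : ℂ) - z)⁻¹ ∂μ
  set c : ℕ → ℂ := fun k => ∫ x : ℝ, (cOrthPoly μ k).eval (x : ℂ) * ((x : ℂ) - z)⁻¹ ∂μ
  have hc : Summable fun n => ‖c n‖ ^ 2 :=
    summable_of_sum_range_le (fun n => by positivity) (sum_norm_sq_integral_le hμ hsupp hz)
  refine Summable.of_nonneg_of_le (fun n => by positivity) (fun n => ?_)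
    ((hc.mul_left 2).add (hP.mul_left (2 * ‖F‖ ^ 2)))
  have h : secondKind μ z n = c n - (cOrthPoly μ n).eval z * F :=
    eq_sub_of_add_eq (integral_mul_inv_eq hμ (cOrthPoly μ n) hz).symm
  have h2 : ‖secondKind μ z n‖ ≤ ‖c n‖ + ‖(cOrthPoly μ n).eval z‖ * ‖F‖ := by
    rw [h, ← norm_mul]
    exact norm_sub_le _ _
  calc ‖secondKind μ z n‖ ^ 2 ≤ (‖c n‖ + ‖(cOrthPoly μ n).eval z‖ * ‖F‖) ^ 2 :=
        pow_le_pow_left₀ (norm_nonneg _) h2 2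
    _ ≤ 2 * (‖c n‖ ^ 2 + (‖(cOrthPoly μ n).eval z‖ * ‖F‖) ^ 2) := add_sq_le
    _ = _ := by ring

theorem degree_divByMonic_cOrthPoly_lt {μ : Measure ℝ} (hμ : HasFiniteMoments μ)
    (hsupp : μ.support.Infinite) (z : ℂ) (n : ℕ) :
    (cOrthPoly μ n /ₘ (X - C z)).degree < n := by
  have hdeg := natDegree_cOrthPoly hμ hsupp n
  rcases Nat.eq_zero_or_pos n with rfl | hn
  · rw [(divByMonic_eq_zero_iff (monic_X_sub_C z)).2]
    · exact WithBot.bot_lt_coe _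
    · rw [degree_X_sub_C]
      refine degree_le_natDegree.trans_lt ?_
      rw [hdeg]
      exact_mod_cast one_pos
  · refine degree_le_natDegree.trans_lt ?_
    rw [natDegree_divByMonic _ (monic_X_sub_C z), hdeg, natDegree_X_sub_C]
    exact_mod_cast Nat.sub_lt hn one_pos

/-- With `r`, `s` the divided differences of `P n`, `P k` at `z`, both `r (P k - P k (z))` and `s (P
n - P n (z))` equal `(X - z) r s`. Integrating, `s * P n` drops out since `s` has degree below `n`.
-/
theorem polyIntegral_divByMonic_mul {μ : Measure ℝ} (hμ : HasFiniteMoments μ)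
    (hsupp : μ.support.Infinite) (z : ℂ) {k n : ℕ} (hkn : k < n) :
    polyIntegral μ ((cOrthPoly μ n /ₘ (X - C z)) * cOrthPoly μ k) =
      (cOrthPoly μ k).eval z * secondKind μ z n - (cOrthPoly μ n).eval z * secondKind μ z k := by
  have hk := eq_C_add_mul_divByMonic (cOrthPoly μ k) z
  have hn := eq_C_add_mul_divByMonic (cOrthPoly μ n) z
  set r := cOrthPoly μ n /ₘ (X - C z) with hr
  set s := cOrthPoly μ k /ₘ (X - C z) with hs
  have h0 : polyIntegral μ (s * cOrthPoly μ n) = 0 :=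
    polyIntegral_mul_cOrthPoly_eq_zero hμ hsupp n s
      ((degree_divByMonic_cOrthPoly_lt hμ hsupp z k).trans (by exact_mod_cast hkn))
  have key : r * cOrthPoly μ k = C ((cOrthPoly μ k).eval z) * r + s * cOrthPoly μ n -
      C ((cOrthPoly μ n).eval z) * s := by
    linear_combination r * hk - s * hn
  rw [key, polyIntegral_sub hμ, polyIntegral_add hμ, polyIntegral_C_mul, polyIntegral_C_mul, h0,
    add_zero]
  rfl

theorem cOrthPoly_eq_add_sum {μ : Measure ℝ} (hμ : HasFiniteMoments μ)
    (hsupp : μ.support.Infinite) (z : ℂ) (n : ℕ) :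
    cOrthPoly μ n = C ((cOrthPoly μ n).eval z) + (X - C z) * ∑ k ∈ Finset.range n,
      C ((cOrthPoly μ k).eval z * secondKind μ z n - (cOrthPoly μ n).eval z * secondKind μ z k) *
        cOrthPoly μ k := by
  have h := eq_C_add_mul_divByMonic (cOrthPoly μ n) z
  rw [eq_sum_polyIntegral hμ hsupp n _ (degree_divByMonic_cOrthPoly_lt hμ hsupp z n)] at h
  rw [Finset.sum_congr rfl fun k hk => by
    rw [polyIntegral_divByMonic_mul hμ hsupp z (Finset.mem_range.1 hk)]] at h
  exact h

/-! ### Weighted norms of polynomials -/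

/-- The weighted norm `∑ ‖p j‖ * R ^ j` of the coefficients of a polynomial. -/
noncomputable def weightedNorm (R : ℝ) (p : ℂ[X]) : ℝ := ∑' j, ‖p.coeff j‖ * R ^ j

theorem summable_coeff_mul_pow (R : ℝ) (p : ℂ[X]) : Summable fun j => ‖p.coeff j‖ * R ^ j :=
  summable_of_ne_finset_zero (s := p.support) fun j hj => by
    rw [notMem_support_iff.1 hj, norm_zero, zero_mul]

theorem weightedNorm_nonneg {R : ℝ} (hR : 0 ≤ R) (p : ℂ[X]) : 0 ≤ weightedNorm R p :=
  tsum_nonneg fun _ => by positivity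

theorem weightedNorm_add_le {R : ℝ} (hR : 0 ≤ R) (p q : ℂ[X]) :
    weightedNorm R (p + q) ≤ weightedNorm R p + weightedNorm R q := by
  rw [weightedNorm, weightedNorm, weightedNorm,
    ← (summable_coeff_mul_pow R p).tsum_add (summable_coeff_mul_pow R q)]
  refine (summable_coeff_mul_pow R _).tsum_le_tsum (fun j => ?_)
    ((summable_coeff_mul_pow R p).add (summable_coeff_mul_pow R q))
  rw [← add_mul, coeff_add]
  exact mul_le_mul_of_nonneg_right (norm_add_le _ _) (by positivity)

theorem weightedNorm_C_mul (R : ℝ) (c : ℂ) (p : ℂ[X]) :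
    weightedNorm R (C c * p) = ‖c‖ * weightedNorm R p := by
  simp only [weightedNorm, coeff_C_mul, norm_mul, mul_assoc]
  exact tsum_mul_left

theorem weightedNorm_C (R : ℝ) (c : ℂ) : weightedNorm R (C c) = ‖c‖ := by
  rw [weightedNorm, tsum_eq_single 0]
  · simp
  · intro j hj
    simp [coeff_C, hj]

theorem weightedNorm_X_mul (R : ℝ) (p : ℂ[X]) :
    weightedNorm R (X * p) = R * weightedNorm R p := by
  rw [weightedNorm, (summable_coeff_mul_pow R _).tsum_eq_zero_add, weightedNorm, ← tsum_mul_left]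
  simp only [coeff_X_mul_zero, norm_zero, zero_mul, zero_add, coeff_X_mul]
  exact tsum_congr fun j => by ring

theorem weightedNorm_X_sub_C_mul_le {R : ℝ} (hR : 0 ≤ R) (z : ℂ) (p : ℂ[X]) :
    weightedNorm R ((X - C z) * p) ≤ (R + ‖z‖) * weightedNorm R p := by
  have h : (X - C z) * p = X * p + C (-z) * p := by simp; ring
  rw [h]
  refine (weightedNorm_add_le hR _ _).trans_eq ?_
  rw [weightedNorm_X_mul, weightedNorm_C_mul, norm_neg]
  ring

theorem weightedNorm_sum_le {R : ℝ} (hR : 0 ≤ R) (s : Finset ℕ) (f : ℕ → ℂ[X]) :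
    weightedNorm R (∑ i ∈ s, f i) ≤ ∑ i ∈ s, weightedNorm R (f i) := by
  induction s using Finset.cons_induction with
  | empty => simp [weightedNorm]
  | cons a s ha ih =>
    rw [Finset.sum_cons, Finset.sum_cons]
    exact (weightedNorm_add_le hR _ _).trans (by gcongr)

/-- Multiplication by `X - z` costs only the factor `R + ‖z‖` in this norm, so the expansion at `z`
bounds `w n` by a sum over `w k`, `k < n`. After Cauchy–Schwarz this is a Gronwall inequality for `w
n ^ 2`, with summable weights because `p` and `q` are square summable. -/
theorem summable_weightedNorm_sq {μ : Measure ℝ} (hμ : HasFiniteMoments μ)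
    (hsupp : μ.support.Infinite) (hindet : IsIndeterminate μ) {R : ℝ} (hR : 0 ≤ R) :
    Summable fun n => weightedNorm R (cOrthPoly μ n) ^ 2 := by
  obtain ⟨z, hz, hP⟩ := exists_summable_norm_sq hμ hsupp hindet
  have hQ := summable_norm_sq_secondKind hμ hsupp hz hP
  set p : ℕ → ℂ := fun n => (cOrthPoly μ n).eval z
  set q : ℕ → ℂ := secondKind μ z
  set A := ∑' n, ‖p n‖ ^ 2
  set B := ∑' n, ‖q n‖ ^ 2
  have hA : 0 ≤ A := tsum_nonneg fun _ => by positivity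
  have hB : 0 ≤ B := tsum_nonneg fun _ => by positivity
  set ρ := R + ‖z‖
  refine summable_of_le_add_mul_sum (a := fun n => 2 * ‖p n‖ ^ 2)
    (b := fun n => 2 * ρ ^ 2 * (2 * (A * ‖q n‖ ^ 2 + B * ‖p n‖ ^ 2))) (fun n => by positivity)
    (fun n => by positivity) (fun n => by positivity) (hP.mul_left 2)
    ((((hQ.mul_left A).add (hP.mul_left B)).mul_left 2).mul_left (2 * ρ ^ 2)) fun n => ?_
  set a : ℕ → ℂ := fun k => p k * q n - p n * q k
  set w : ℕ → ℝ := fun k => weightedNorm R (cOrthPoly μ k) with hw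
  have hρ : 0 ≤ ρ := by positivity
  have h1 : w n ≤ ‖p n‖ + ρ * ∑ k ∈ Finset.range n, ‖a k‖ * w k := by
    simp only [hw]
    conv_lhs => rw [cOrthPoly_eq_add_sum hμ hsupp z n]
    refine (weightedNorm_add_le hR _ _).trans ?_
    rw [weightedNorm_C]
    refine add_le_add le_rfl ((weightedNorm_X_sub_C_mul_le hR z _).trans ?_)
    refine mul_le_mul_of_nonneg_left ((weightedNorm_sum_le hR _ _).trans_eq ?_) hρ
    exact Finset.sum_congr rfl fun k _ => weightedNorm_C_mul _ _ _
  have h2 : (∑ k ∈ Finset.range n, ‖a k‖ * w k) ^ 2 ≤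
      (∑ k ∈ Finset.range n, ‖a k‖ ^ 2) * ∑ k ∈ Finset.range n, w k ^ 2 :=
    Finset.sum_mul_sq_le_sq_mul_sq _ _ _
  have h3 : ∑ k ∈ Finset.range n, ‖a k‖ ^ 2 ≤ 2 * (A * ‖q n‖ ^ 2 + B * ‖p n‖ ^ 2) := by
    have hpa : ∑ k ∈ Finset.range n, ‖p k‖ ^ 2 ≤ A :=
      hP.sum_le_tsum _ fun _ _ => by positivity
    have hqb : ∑ k ∈ Finset.range n, ‖q k‖ ^ 2 ≤ B :=
      hQ.sum_le_tsum _ fun _ _ => by positivity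
    calc ∑ k ∈ Finset.range n, ‖a k‖ ^ 2
        ≤ ∑ k ∈ Finset.range n, (2 * ‖q n‖ ^ 2 * ‖p k‖ ^ 2 + 2 * ‖p n‖ ^ 2 * ‖q k‖ ^ 2) := by
          refine Finset.sum_le_sum fun k _ => ?_
          have h : ‖a k‖ ≤ ‖p k‖ * ‖q n‖ + ‖p n‖ * ‖q k‖ := by
            rw [← norm_mul, ← norm_mul]
            exact norm_sub_le _ _
          refine (pow_le_pow_left₀ (norm_nonneg _) h 2).trans (add_sq_le.trans_eq (by ring))
      _ = 2 * ‖q n‖ ^ 2 * ∑ k ∈ Finset.range n, ‖p k‖ ^ 2 +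
          2 * ‖p n‖ ^ 2 * ∑ k ∈ Finset.range n, ‖q k‖ ^ 2 := by
          rw [Finset.sum_add_distrib, Finset.mul_sum, Finset.mul_sum]
      _ ≤ 2 * ‖q n‖ ^ 2 * A + 2 * ‖p n‖ ^ 2 * B := by gcongr
      _ = _ := by ring
  have hwn : 0 ≤ w n := weightedNorm_nonneg hR _
  calc w n ^ 2 ≤ (‖p n‖ + ρ * ∑ k ∈ Finset.range n, ‖a k‖ * w k) ^ 2 :=
        pow_le_pow_left₀ hwn h1 2
    _ ≤ 2 * (‖p n‖ ^ 2 + (ρ * ∑ k ∈ Finset.range n, ‖a k‖ * w k) ^ 2) := add_sq_le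
    _ = 2 * ‖p n‖ ^ 2 + 2 * ρ ^ 2 * (∑ k ∈ Finset.range n, ‖a k‖ * w k) ^ 2 := by ring
    _ ≤ 2 * ‖p n‖ ^ 2 + 2 * ρ ^ 2 * ((2 * (A * ‖q n‖ ^ 2 + B * ‖p n‖ ^ 2)) *
          ∑ k ∈ Finset.range n, w k ^ 2) := by
        gcongr
        exact h2.trans (mul_le_mul_of_nonneg_right h3
          (Finset.sum_nonneg fun _ _ => by positivity))
    _ = _ := by ring

/-! ### The power series of the kernel -/

theorem iteratedDeriv_of_forall_hasSum {c : ℕ → ℂ} {f : ℂ → ℂ}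
    (h : ∀ z, HasSum (fun j => c j * z ^ j) (f z)) (n : ℕ) :
    iteratedDeriv n f 0 = (n.factorial : ℂ) * c n := by
  have hps : HasFPowerSeriesOnBall f (FormalMultilinearSeries.ofScalars ℂ c) 0 ⊤ := by
    refine ⟨?_, by simp, fun {y} _ => ?_⟩
    · refine le_of_eq (ENNReal.eq_top_of_forall_nnreal_le fun r => ?_).symm
      refine FormalMultilinearSeries.le_radius_of_summable_norm _ ?_
      have := (h r).summable.norm
      refine this.congr fun j => ?_
      rw [FormalMultilinearSeries.ofScalars_norm]
      simp
    · rw [zero_add]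
      simpa [FormalMultilinearSeries.ofScalars, mul_comm] using h y
  have := hps.factorial_smul (1 : ℂ) n
  rw [iteratedDeriv_eq_iteratedFDeriv, ← this]
  simp [FormalMultilinearSeries.ofScalars]

theorem hasSum_eval (p : ℂ[X]) (z : ℂ) : HasSum (fun j => p.coeff j * z ^ j) (p.eval z) := by
  rw [eval_eq_sum, Polynomial.sum]
  exact hasSum_sum_of_ne_finset_zero fun j hj => by rw [notMem_support_iff.1 hj, zero_mul]

theorem norm_eval_le_weightedNorm (p : ℂ[X]) (z : ℂ) : ‖p.eval z‖ ≤ weightedNorm ‖z‖ p := by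
  rw [← (hasSum_eval p z).tsum_eq, weightedNorm]
  have h := summable_coeff_mul_pow ‖z‖ p
  simp_rw [← norm_pow, ← norm_mul] at h ⊢
  exact norm_tsum_le_tsum_norm h

theorem hasSum_weightedNorm (R : ℝ) (p : ℂ[X]) :
    HasSum (fun j => ‖p.coeff j‖ * R ^ j) (weightedNorm R p) :=
  (summable_coeff_mul_pow R p).hasSum

/-- Absolute convergence of the full triple series, from `u v ≤ u² + v²` for the weighted norms;
every later rearrangement of the kernel relies on it. -/
theorem summable_kernel_triple {μ : Measure ℝ} (hμ : HasFiniteMoments μ)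
    (hsupp : μ.support.Infinite) (hindet : IsIndeterminate μ) (z w : ℂ) :
    Summable fun t : ℕ × (ℕ × ℕ) => ((cOrthPoly μ t.1).coeff t.2.1 * z ^ t.2.1) *
      ((cOrthPoly μ t.1).coeff t.2.2 * w ^ t.2.2) := by
  refine Summable.of_norm ?_
  simp only [norm_mul, norm_pow]
  have hsum (n : ℕ) := (summable_coeff_mul_pow ‖z‖ (cOrthPoly μ n)).mul_of_nonneg
    (summable_coeff_mul_pow ‖w‖ (cOrthPoly μ n)) (fun _ => by positivity) (fun _ => by positivity)
  rw [summable_prod_of_nonneg fun _ => by positivity]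
  refine ⟨hsum, ?_⟩
  have htsum (n : ℕ) := (hasSum_weightedNorm ‖z‖ (cOrthPoly μ n)).mul
    (hasSum_weightedNorm ‖w‖ (cOrthPoly μ n)) (hsum n)
  simp only [fun n => (htsum n).tsum_eq]
  refine Summable.of_nonneg_of_le
    (fun n => mul_nonneg (weightedNorm_nonneg (norm_nonneg _) _)
      (weightedNorm_nonneg (norm_nonneg _) _)) (fun n => ?_)
    ((summable_weightedNorm_sq hμ hsupp hindet (norm_nonneg z)).add
      (summable_weightedNorm_sq hμ hsupp hindet (norm_nonneg w)))
  nlinarith [sq_nonneg (weightedNorm ‖z‖ (cOrthPoly μ n) - weightedNorm ‖w‖ (cOrthPoly μ n)),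
    sq_nonneg (weightedNorm ‖z‖ (cOrthPoly μ n)), sq_nonneg (weightedNorm ‖w‖ (cOrthPoly μ n))]

theorem summable_norm_sq_aeval {μ : Measure ℝ} (hμ : HasFiniteMoments μ)
    (hsupp : μ.support.Infinite) (hindet : IsIndeterminate μ) (z : ℂ) :
    Summable fun n : ℕ => ‖aeval z (orthPoly μ n)‖ ^ 2 := by
  refine Summable.of_nonneg_of_le (fun n => by positivity) (fun n => ?_)
    (summable_weightedNorm_sq hμ hsupp hindet (norm_nonneg z))
  rw [← eval_cOrthPoly]
  exact pow_le_pow_left₀ (norm_nonneg _) (norm_eval_le_weightedNorm _ _) 2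

theorem summable_coeff_mul_coeff {μ : Measure ℝ} (hμ : HasFiniteMoments μ)
    (hsupp : μ.support.Infinite) (hindet : IsIndeterminate μ) (j k : ℕ) :
    Summable fun n => (cOrthPoly μ n).coeff j * (cOrthPoly μ n).coeff k := by
  have := (summable_kernel_triple hμ hsupp hindet 1 1).comp_injective
    (i := fun n : ℕ => (n, (j, k))) (fun a b h => (Prod.ext_iff.1 h).1)
  simpa [Function.comp_def] using this

theorem hasSum_kernelK {μ : Measure ℝ} (hμ : HasFiniteMoments μ)
    (hsupp : μ.support.Infinite) (hindet : IsIndeterminate μ) (z w : ℂ) :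
    HasSum (fun p : ℕ × ℕ => (∑' n, (cOrthPoly μ n).coeff p.1 * (cOrthPoly μ n).coeff p.2) *
      z ^ p.1 * w ^ p.2) (kernelK μ z w) := by
  have hF := summable_kernel_triple hμ hsupp hindet z w
  have h1 : ∑' t : ℕ × (ℕ × ℕ), ((cOrthPoly μ t.1).coeff t.2.1 * z ^ t.2.1) *
      ((cOrthPoly μ t.1).coeff t.2.2 * w ^ t.2.2) = kernelK μ z w := by
    rw [hF.tsum_prod, kernelK]
    refine tsum_congr fun n => ?_
    have := (hasSum_eval (cOrthPoly μ n) z).mul (hasSum_eval (cOrthPoly μ n) w)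
      (hF.prod_factor n)
    rw [this.tsum_eq, eval_cOrthPoly, eval_cOrthPoly]
  rw [← h1]
  have h2 := (Equiv.prodComm (ℕ × ℕ) ℕ).hasSum_iff.2 hF.hasSum
  refine h2.prod_fiberwise fun p => ?_
  have := (((summable_coeff_mul_coeff hμ hsupp hindet p.1 p.2).hasSum.mul_right (z ^ p.1)).mul_right
    (w ^ p.2))
  refine this.congr_fun fun n => ?_
  simp only [Function.comp_apply, Equiv.prodComm_apply, Prod.swap_prod_mk]
  ring

theorem kernelCoeff_eq_tsum {μ : Measure ℝ} (hμ : HasFiniteMoments μ)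
    (hsupp : μ.support.Infinite) (hindet : IsIndeterminate μ) (j k : ℕ) :
    kernelCoeff μ j k = ∑' n, (cOrthPoly μ n).coeff j * (cOrthPoly μ n).coeff k := by
  set a : ℕ → ℕ → ℂ := fun j k => ∑' n, (cOrthPoly μ n).coeff j * (cOrthPoly μ n).coeff k
  have hK (z w : ℂ) : HasSum (fun p : ℕ × ℕ => a p.1 p.2 * z ^ p.1 * w ^ p.2) (kernelK μ z w) :=
    hasSum_kernelK hμ hsupp hindet z w
  have hcol (z : ℂ) (k : ℕ) : Summable fun j => a j k * z ^ j := by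
    have := (hK z 1).summable.comp_injective (i := fun j : ℕ => (j, k))
      (fun a b h => (Prod.ext_iff.1 h).1)
    simpa [Function.comp_def] using this
  have hw (z : ℂ) : iteratedDeriv k (fun w => kernelK μ z w) 0 =
      (k.factorial : ℂ) * ∑' j, a j k * z ^ j := by
    refine iteratedDeriv_of_forall_hasSum (c := fun k => ∑' j, a j k * z ^ j) (fun w => ?_) k
    have h2 := (Equiv.prodComm ℕ ℕ).hasSum_iff.2 (hK z w)
    exact h2.prod_fiberwise fun k => (hcol z k).hasSum.mul_right (w ^ k)
  have hz : iteratedDeriv j (fun z => (k.factorial : ℂ) * ∑' j, a j k * z ^ j) 0 =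
      (j.factorial : ℂ) * ((k.factorial : ℂ) * a j k) := by
    refine iteratedDeriv_of_forall_hasSum (c := fun j => (k.factorial : ℂ) * a j k) (fun z => ?_) j
    simpa [mul_assoc] using (hcol z k).hasSum.mul_left (k.factorial : ℂ)
  rw [kernelCoeff]
  simp_rw [hw]
  rw [hz]
  have h1 : (j.factorial : ℂ) ≠ 0 := by exact_mod_cast j.factorial_ne_zero
  have h2 : (k.factorial : ℂ) ≠ 0 := by exact_mod_cast k.factorial_ne_zero
  field_simp
  rfl

/-! ### Absolutely convergent sums of positive operators of rank one -/

section FrameOperator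

variable {H : Type} [NormedAddCommGroup H] [InnerProductSpace ℂ H]

/-- The operator `x ↦ ∑ ⟨b n, x⟩ b n`. -/
noncomputable def frameOp (b : ℕ → H) : H →L[ℂ] H :=
  ∑' n, InnerProductSpace.rankOne ℂ (b n) (b n)

/-- The operator `x ↦ ∑ n ≤ N, ⟨b n, x⟩ b n`. -/
noncomputable def frameOpTrunc (b : ℕ → H) (N : ℕ) : H →L[ℂ] H :=
  ∑ n ∈ Finset.range (N + 1), InnerProductSpace.rankOne ℂ (b n) (b n)

theorem frameOpTrunc_apply (b : ℕ → H) (N : ℕ) (x : H) :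
    frameOpTrunc b N x = ∑ n ∈ Finset.range (N + 1), inner ℂ (b n) x • b n := by
  simp [frameOpTrunc]

theorem inner_frameOpTrunc (b : ℕ → H) (N : ℕ) (x y : H) :
    inner ℂ x (frameOpTrunc b N y) = inner ℂ (frameOpTrunc b N x) y := by
  simp only [frameOpTrunc_apply, inner_sum, sum_inner, inner_smul_left, inner_smul_right,
    inner_conj_symm]
  exact Finset.sum_congr rfl fun n _ => mul_comm _ _

theorem hasSum_frameOp [CompleteSpace H] {b : ℕ → H}
    (hb : Summable fun n => ‖b n‖ ^ 2) :
    HasSum (fun n => InnerProductSpace.rankOne ℂ (b n) (b n)) (frameOp b) := by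
  refine Summable.hasSum (Summable.of_norm (hb.congr fun n => ?_))
  rw [InnerProductSpace.norm_rankOne, sq]

theorem tendsto_frameOpTrunc [CompleteSpace H] {b : ℕ → H}
    (hb : Summable fun n => ‖b n‖ ^ 2) :
    Tendsto (frameOpTrunc b) atTop (𝓝 (frameOp b)) :=
  (hasSum_frameOp hb).tendsto_sum_nat.comp (tendsto_add_atTop_nat 1)

theorem hasSum_frameOp_apply [CompleteSpace H] {b : ℕ → H}
    (hb : Summable fun n => ‖b n‖ ^ 2) (x : H) :
    HasSum (fun n => inner ℂ (b n) x • b n) (frameOp b x) := by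
  have := (hasSum_frameOp hb).mapL (ContinuousLinearMap.apply ℂ H x)
  simpa using this

theorem hasSum_inner_frameOp [CompleteSpace H] {b : ℕ → H}
    (hb : Summable fun n => ‖b n‖ ^ 2) (x : H) :
    HasSum (fun n => ((‖inner ℂ (b n) x‖ ^ 2 : ℝ) : ℂ)) (inner ℂ (frameOp b x) x) := by
  have h := (hasSum_frameOp_apply hb x).mapL (innerSL ℂ x)
  simp only [innerSL_apply_apply, inner_smul_right] at h
  have h2 := h.star
  have h3 : star (inner ℂ x (frameOp b x)) = inner ℂ (frameOp b x) x := inner_conj_symm _ _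
  rw [h3] at h2
  refine h2.congr_fun fun n => ?_
  have h4 : inner ℂ x (b n) = starRingEnd ℂ (inner ℂ (b n) x) := (inner_conj_symm _ _).symm
  rw [h4, Complex.mul_conj']
  simp

theorem hasSum_re_inner_frameOp [CompleteSpace H] {b : ℕ → H}
    (hb : Summable fun n => ‖b n‖ ^ 2) (x : H) :
    HasSum (fun n => ‖inner ℂ (b n) x‖ ^ 2) (inner ℂ (frameOp b x) x).re := by
  simpa only [Complex.ofReal_re] using Complex.hasSum_re (hasSum_inner_frameOp hb x)

theorem isPositive_frameOp [CompleteSpace H] {b : ℕ → H}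
    (hb : Summable fun n => ‖b n‖ ^ 2) :
    (frameOp b).IsPositive := by
  rw [ContinuousLinearMap.isPositive_iff_complex]
  intro x
  refine ⟨?_, (hasSum_re_inner_frameOp hb x).nonneg fun _ => by positivity⟩
  have h1 := hasSum_inner_frameOp hb x
  have h2 := Complex.hasSum_ofReal.2 (hasSum_re_inner_frameOp hb x)
  exact h2.unique h1

/-- The operator is positive, so it is its own absolute value. By Parseval for each `b n`, the
double series `∑ |⟨b n, e i⟩|²` has sum `∑ ‖b n‖²` in any orthonormal basis. -/
theorem isTraceClass_frameOp [CompleteSpace H] {b : ℕ → H}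
    (hb : Summable fun n => ‖b n‖ ^ 2) :
    IsTraceClass (frameOp b) := by
  intro ι e
  rw [CFC.abs_of_nonneg _ ((ContinuousLinearMap.nonneg_iff_isPositive _).2
    (isPositive_frameOp hb))]
  have hpars (n : ℕ) : HasSum (fun i => ‖inner ℂ (b n) (e i)‖ ^ 2) (‖b n‖ ^ 2) := by
    have h := Complex.hasSum_re (e.hasSum_inner_mul_inner (b n) (b n))
    rw [inner_self_eq_norm_sq_to_K] at h
    have h2 : ((‖b n‖ : ℂ) ^ 2).re = ‖b n‖ ^ 2 := by
      rw [← Complex.ofReal_pow, Complex.ofReal_re]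
    refine (h2 ▸ h).congr_fun fun i => ?_
    rw [← inner_conj_symm (e i) (b n), Complex.mul_conj', ← Complex.ofReal_pow,
      Complex.ofReal_re]
  have hs : Summable fun p : ℕ × ι => ‖inner ℂ (b p.1) (e p.2)‖ ^ 2 := by
    rw [summable_prod_of_nonneg fun _ => by positivity]
    refine ⟨fun n => (hpars n).summable, ?_⟩
    simp only [fun n => (hpars n).tsum_eq]
    exact hb
  have h3 := ((Equiv.prodComm ι ℕ).summable_iff.2 hs).prod
  refine h3.congr fun i => ?_
  rw [← (hasSum_re_inner_frameOp hb (e i)).tsum_eq]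
  rfl

theorem isCompactOperator_rankOne (x y : H) :
    IsCompactOperator (InnerProductSpace.rankOne ℂ x y) := by
  have h1 : IsCompactOperator (id : ℂ → ℂ) :=
    isCompactOperator_id_iff_finiteDimensional (𝕜 := ℂ).2 inferInstance
  exact (h1.comp_clm (innerSL ℂ y)).clm_comp (ContinuousLinearMap.toSpanSingleton ℂ x)

theorem isCompactOperator_frameOp [CompleteSpace H] {b : ℕ → H}
    (hb : Summable fun n => ‖b n‖ ^ 2) :
    IsCompactOperator (frameOp b) := by
  refine isCompactOperator_of_tendsto (tendsto_frameOpTrunc hb) (Eventually.of_forall fun N => ?_)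
  unfold frameOpTrunc
  generalize N + 1 = M
  induction M with
  | zero => simpa using isCompactOperator_zero
  | succ M ih =>
    rw [Finset.sum_range_succ]
    exact ih.add (isCompactOperator_rankOne _ _)

end FrameOperator

/-! ### The spectrum as a limit of the spectra of the truncations -/

section Spectrum

variable {H : Type} [NormedAddCommGroup H] [InnerProductSpace ℂ H]

/-- Eigenvalues make `s N - T N` a non-unit, and non-units form a closed set. -/
theorem mem_spectrum_of_tendsto [CompleteSpace H] {T : ℕ → H →L[ℂ] H} {A : H →L[ℂ] H}
    (hT : Tendsto T atTop (𝓝 A))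
    {s : ℕ → ℂ} {t : ℂ} (hs : Tendsto s atTop (𝓝 t))
    (h : ∀ᶠ N in atTop, ∃ v : H, v ≠ 0 ∧ T N v = s N • v) : t ∈ spectrum ℂ A := by
  have hlim : Tendsto (fun N => algebraMap ℂ (H →L[ℂ] H) (s N) - T N) atTop
      (𝓝 (algebraMap ℂ (H →L[ℂ] H) t - A)) :=
    (((continuous_algebraMap ℂ (H →L[ℂ] H)).tendsto t).comp hs).sub hT
  refine nonunits.isClosed.mem_of_tendsto hlim ?_
  filter_upwards [h] with N hN
  obtain ⟨v, hv, hTv⟩ := hN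
  rintro ⟨u, hu⟩
  refine hv ?_
  have h1 : (u : H →L[ℂ] H) v = 0 := by
    rw [hu]
    simp [hTv, Algebra.algebraMap_eq_smul_one]
  calc v = (((u⁻¹ : (H →L[ℂ] H)ˣ) : H →L[ℂ] H) * (u : H →L[ℂ] H)) v := by
        rw [Units.inv_mul]; rfl
    _ = ((u⁻¹ : (H →L[ℂ] H)ˣ) : H →L[ℂ] H) ((u : H →L[ℂ] H) v) := rfl
    _ = 0 := by rw [h1, map_zero]

theorem norm_sq_sum_smul_orthonormal {ι : Type*} [Fintype ι] {e : ι → H} (he : Orthonormal ℂ e)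
    (c : ι → ℂ) : ‖∑ i, c i • e i‖ ^ 2 = ∑ i, ‖c i‖ ^ 2 := by
  have h := he.inner_sum c c Finset.univ
  rw [inner_self_eq_norm_sq_to_K] at h
  simp only [Complex.conj_mul'] at h
  exact Complex.ofReal_injective (by simpa using h)

/-- The part of `v` orthogonal to all `e i` is orthogonal to every `b m` with `m ≤ N`, hence is
annihilated. -/
theorem frameOpTrunc_eq_sum {b : ℕ → H} {N : ℕ} {ι : Type*} [Fintype ι] {e : ι → H}
    (he : Orthonormal ℂ e) {s : ι → ℝ} (hes : ∀ i, frameOpTrunc b N (e i) = (s i : ℂ) • e i)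
    (hspan : ∀ m ≤ N, b m ∈ Submodule.span ℂ (Set.range e)) (v : H) :
    frameOpTrunc b N v = ∑ i, ((s i : ℂ) * inner ℂ (e i) v) • e i := by
  set w := v - ∑ i, inner ℂ (e i) v • e i with hw
  have hew (i : ι) : inner ℂ (e i) w = 0 := by
    rw [hw, inner_sub_right, he.inner_right_fintype, sub_self]
  have hbw : ∀ m ≤ N, inner ℂ (b m) w = 0 := by
    intro m hm
    have hle : Submodule.span ℂ (Set.range e) ≤ (Submodule.span ℂ {w})ᗮ := by
      rw [Submodule.span_le]
      rintro _ ⟨i, rfl⟩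
      exact Submodule.mem_orthogonal_singleton_iff_inner_left.2 (hew i)
    exact Submodule.mem_orthogonal_singleton_iff_inner_left.1 (hle (hspan m hm))
  have hTw : frameOpTrunc b N w = 0 := by
    rw [frameOpTrunc_apply]
    refine Finset.sum_eq_zero fun m hm => ?_
    rw [hbw m (Nat.lt_succ_iff.1 (Finset.mem_range.1 hm)), zero_smul]
  have hv : v = w + ∑ i, inner ℂ (e i) v • e i := by rw [hw]; abel
  conv_lhs => rw [hv]
  rw [map_add, hTw, zero_add, map_sum]
  refine Finset.sum_congr rfl fun i _ => ?_
  rw [map_smul, hes, smul_smul, mul_comm]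

/-- In the eigenbasis, `s i ⟨e i, v⟩` is compared with `(s i - t) ⟨e i, v⟩`, and Bessel bounds the
latter. Estimating the image of `v` rather than `v` removes the component outside the span. -/
theorem norm_sq_frameOpTrunc_le {b : ℕ → H} {N : ℕ} {ι : Type*} [Fintype ι] {e : ι → H}
    (he : Orthonormal ℂ e) {s : ι → ℝ} (hes : ∀ i, frameOpTrunc b N (e i) = (s i : ℂ) • e i)
    (hspan : ∀ m ≤ N, b m ∈ Submodule.span ℂ (Set.range e)) {K δ : ℝ} (hK : ∀ i, |s i| ≤ K)
    {t : ℂ} (hδ : 0 < δ) (ht : ∀ i, δ ≤ ‖(s i : ℂ) - t‖) (v : H) :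
    ‖frameOpTrunc b N v‖ ^ 2 ≤ (K / δ) ^ 2 * ‖frameOpTrunc b N v - t • v‖ ^ 2 := by
  rw [frameOpTrunc_eq_sum he hes hspan v, norm_sq_sum_smul_orthonormal he,
    ← frameOpTrunc_eq_sum he hes hspan v]
  have hbessel := he.sum_inner_products_le (x := frameOpTrunc b N v - t • v) (s := Finset.univ)
  refine le_trans ?_ (mul_le_mul_of_nonneg_left hbessel (sq_nonneg _))
  rw [Finset.mul_sum]
  refine Finset.sum_le_sum fun i _ => ?_
  rw [inner_sub_right, inner_frameOpTrunc, hes, inner_smul_left, inner_smul_right,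
    Complex.conj_ofReal, ← sub_mul, norm_mul, norm_mul, ← mul_pow]
  refine pow_le_pow_left₀ (by positivity) ?_ 2
  rw [← mul_assoc]
  refine mul_le_mul_of_nonneg_right ?_ (norm_nonneg _)
  rw [Complex.norm_real, Real.norm_eq_abs]
  have hK0 : 0 ≤ K := (abs_nonneg _).trans (hK i)
  calc |s i| ≤ K := hK i
    _ = K / δ * δ := by field_simp
    _ ≤ _ := mul_le_mul_of_nonneg_left (ht i) (by positivity)

/-- Finitely many indices are handled by pointwise convergence; for the remaining ones `K / (n + 1)
≤ ‖t‖ / 2`, uniformly in `N`. -/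
theorem exists_pos_eventually_le_norm_sub {s : ℕ → ℕ → ℝ} {σ : ℕ → ℝ} {K : ℝ} (hK : 0 < K)
    (hlim : ∀ n, Tendsto (fun N => s N n) atTop (𝓝 (σ n)))
    (hs : ∀ N n, n ≤ N → |s N n| ≤ K / (n + 1)) {t : ℂ} (ht : t ≠ 0)
    (hσ : ∀ n, (σ n : ℂ) ≠ t) :
    ∃ δ > 0, ∀ᶠ N in atTop, ∀ n ≤ N, δ ≤ ‖(s N n : ℂ) - t‖ := by
  have hfin (M : ℕ) : ∃ δ > 0, ∀ᶠ N in atTop, ∀ n < M, δ ≤ ‖(s N n : ℂ) - t‖ := by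
    induction M with
    | zero => exact ⟨1, one_pos, Eventually.of_forall fun _ n hn => absurd hn (Nat.not_lt_zero n)⟩
    | succ M ih =>
      obtain ⟨δ, hδ, h⟩ := ih
      have hpos : 0 < ‖(σ M : ℂ) - t‖ := norm_pos_iff.2 (sub_ne_zero.2 (hσ M))
      have hl : Tendsto (fun N => ‖(s N M : ℂ) - t‖) atTop (𝓝 ‖(σ M : ℂ) - t‖) :=
        (((Complex.continuous_ofReal.tendsto _).comp (hlim M)).sub_const t).norm
      refine ⟨min δ (‖(σ M : ℂ) - t‖ / 2), lt_min hδ (half_pos hpos), ?_⟩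
      filter_upwards [h, hl.eventually_const_le (half_lt_self hpos)] with N h1 h2 n hn
      rcases (Nat.lt_succ_iff.1 hn).eq_or_lt with rfl | hlt
      · exact (min_le_right _ _).trans h2
      · exact (min_le_left _ _).trans (h1 n hlt)
  have htpos : 0 < ‖t‖ := norm_pos_iff.2 ht
  obtain ⟨M, hM⟩ := exists_nat_gt (K / (‖t‖ / 2))
  obtain ⟨δ, hδ, h⟩ := hfin M
  refine ⟨min δ (‖t‖ / 2), lt_min hδ (half_pos htpos), ?_⟩
  filter_upwards [h] with N hN n hn
  rcases lt_or_ge n M with hlt | hge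
  · exact (min_le_left _ _).trans (hN n hlt)
  · refine (min_le_right _ _).trans ?_
    have h1 : |s N n| ≤ ‖t‖ / 2 := by
      refine (hs N n hn).trans ?_
      rw [div_le_iff₀ (by positivity)]
      rw [div_lt_iff₀ (by positivity)] at hM
      have : (M : ℝ) ≤ n := by exact_mod_cast hge
      nlinarith
    have h2 := norm_sub_norm_le t (s N n : ℂ)
    rw [Complex.norm_real, Real.norm_eq_abs, norm_sub_rev] at h2
    linarith

theorem spectrum_frameOp [CompleteSpace H] {b : ℕ → H}
    (hb : Summable fun n => ‖b n‖ ^ 2)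
    {e : ∀ N : ℕ, Fin (N + 1) → H} (he : ∀ N, Orthonormal ℂ (e N)) {s : ℕ → ℕ → ℝ}
    (hes : ∀ N i, frameOpTrunc b N (e N i) = (s N i : ℂ) • e N i)
    (hspan : ∀ N, ∀ m ≤ N, b m ∈ Submodule.span ℂ (Set.range (e N)))
    {K : ℝ} (hK : 0 < K) (hs : ∀ N n, n ≤ N → |s N n| ≤ K / (n + 1)) {σ : ℕ → ℝ}
    (hlim : ∀ n, Tendsto (fun N => s N n) atTop (𝓝 (σ n))) :
    spectrum ℂ (frameOp b) = {0} ∪ Set.range fun n => (σ n : ℂ) := by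
  have hmem (n : ℕ) : (σ n : ℂ) ∈ spectrum ℂ (frameOp b) := by
    refine mem_spectrum_of_tendsto (tendsto_frameOpTrunc hb)
      ((Complex.continuous_ofReal.tendsto _).comp (hlim n)) ?_
    filter_upwards [eventually_ge_atTop n] with N hN
    exact ⟨e N ⟨n, Nat.lt_succ_iff.2 hN⟩, (he N).ne_zero _, hes N _⟩
  have hσK (n : ℕ) : |σ n| ≤ K / (n + 1) :=
    le_of_tendsto (hlim n).abs ((eventually_ge_atTop n).mono fun N hN => hs N n hN)
  apply Set.Subset.antisymm
  · intro t ht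
    by_contra hcon
    simp only [Set.singleton_union, Set.mem_insert_iff, Set.mem_range, not_or, not_exists] at hcon
    obtain ⟨ht0, hσ⟩ := hcon
    -- Compactness supplies an eigenvector `v` for `t ≠ 0`. The truncations send `v` to vectors
    -- tending to `t • v`, yet the residual estimate forces that limit to be zero.
    obtain ⟨v, hv⟩ := (((isCompactOperator_frameOp hb).hasEigenvalue_iff_mem_spectrum
      ht0).2 ht).exists_hasEigenvector
    have hAv : frameOp b v = t • v := hv.apply_eq_smul
    obtain ⟨δ, hδ, hev⟩ := exists_pos_eventually_le_norm_sub hK hlim hs ht0 hσ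
    have hT : Tendsto (fun N => frameOpTrunc b N v) atTop (𝓝 (t • v)) := by
      rw [← hAv]
      exact ((ContinuousLinearMap.apply ℂ H v).continuous.tendsto _).comp
        (tendsto_frameOpTrunc hb)
    have h1 : Tendsto (fun N => ‖frameOpTrunc b N v‖ ^ 2) atTop (𝓝 (‖t • v‖ ^ 2)) := hT.norm.pow 2
    have h2 : Tendsto (fun N => (K / δ) ^ 2 * ‖frameOpTrunc b N v - t • v‖ ^ 2) atTop
        (𝓝 ((K / δ) ^ 2 * ‖t • v - t • v‖ ^ 2)) :=
      ((hT.sub_const _).norm.pow 2).const_mul _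
    have h3 := le_of_tendsto_of_tendsto h1 h2 (hev.mono fun N hN =>
      norm_sq_frameOpTrunc_le (he N) (s := fun i => s N i) (hes N) (hspan N) (fun i => by
        refine (hs N i (Nat.lt_succ_iff.1 i.2)).trans (div_le_self hK.le ?_)
        have : (0 : ℝ) ≤ (i : ℕ) := Nat.cast_nonneg _
        linarith) hδ (fun i => hN i (Nat.lt_succ_iff.1 i.2)) v)
    rw [sub_self, norm_zero, zero_pow two_ne_zero, mul_zero] at h3
    have h4 : t • v = 0 := by
      rw [← norm_eq_zero]
      exact pow_eq_zero_iff two_ne_zero |>.1 (le_antisymm h3 (sq_nonneg _))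
    exact (smul_ne_zero ht0 hv.2) h4
  · rintro t (rfl | ⟨n, rfl⟩)
    -- Zero belongs to the spectrum as the limit of the `σ n`, the spectrum being closed.
    · have h0 : Tendsto (fun n => (σ n : ℂ)) atTop (𝓝 0) := by
        have hz : Tendsto (fun n : ℕ => K / ((n : ℝ) + 1)) atTop (𝓝 0) := by
          simpa [div_eq_mul_inv] using (tendsto_one_div_add_atTop_nhds_zero_nat (𝕜 := ℝ)).const_mul K
        refine squeeze_zero_norm (fun n => ?_) hz
        rw [Complex.norm_real]
        exact hσK n
      exact (spectrum.isClosed (𝕜 := ℂ) (frameOp b)).mem_of_tendsto h0 (Eventually.of_forall hmem)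
    · exact hmem n

end Spectrum

/-! ### Interlacing of eigenvalues -/

/-- Cauchy interlacing by counting dimensions: some `x ≠ 0` is orthogonal to `u i` for `i > n` while
`J x` is orthogonal to `u' i` for `i < n`. Its form value then lies between `l' n ‖x‖²` and `l n
‖x‖²`. -/
theorem eigenvalue_le_of_isometry {E E' : Type*} [NormedAddCommGroup E] [InnerProductSpace ℝ E]
    [NormedAddCommGroup E'] [InnerProductSpace ℝ E'] {N : ℕ} (J : E →ₗ[ℝ] E')
    (hJ : ∀ x, ‖J x‖ = ‖x‖) {q : E → ℝ} {q' : E' → ℝ} (hq : ∀ x, q' (J x) = q x)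
    (u : OrthonormalBasis (Fin (N + 1)) ℝ E) (u' : OrthonormalBasis (Fin (N + 2)) ℝ E')
    {l l' : ℕ → ℝ} (hl : Monotone l) (hl' : Monotone l')
    (hu : ∀ x, q x = ∑ i : Fin (N + 1), l i * inner ℝ (u i) x ^ 2)
    (hu' : ∀ x, q' x = ∑ i : Fin (N + 2), l' i * inner ℝ (u' i) x ^ 2) {n : ℕ} (hn : n ≤ N) :
    l' n ≤ l n := by
  -- These are `n + (N - n) = N` conditions on a space of dimension `N + 1`; `i.succ` runs through
  -- `n + 1, …, N` in the second group.
  let g : E →ₗ[ℝ] (Fin N → ℝ) := LinearMap.pi fun i : Fin N =>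
    if (i : ℕ) < n then (innerₛₗ ℝ (u' i.castSucc.castSucc)) ∘ₗ J else innerₛₗ ℝ (u i.succ)
  have : FiniteDimensional ℝ E := u.toBasis.finiteDimensional_of_finite
  have hfin : Module.finrank ℝ E = N + 1 := by
    rw [Module.finrank_eq_card_basis u.toBasis, Fintype.card_fin]
  have hker : LinearMap.ker g ≠ ⊥ := g.ker_ne_bot_of_finrank_lt (by simp [hfin])
  obtain ⟨x, hx, hx0⟩ := (Submodule.ne_bot_iff _).1 hker
  have hg (i : Fin N) : g x i = 0 := congrFun (LinearMap.mem_ker.1 hx) i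
  have h1 (i : Fin (N + 1)) (hi : n < i) : inner ℝ (u i) x = 0 := by
    obtain ⟨j, rfl⟩ := Fin.exists_succ_eq_of_ne_zero (x := i) (by rintro rfl; simp at hi)
    have := hg j
    rw [Fin.val_succ] at hi
    simpa [g, show ¬ (j : ℕ) < n by omega] using this
  have h2 (i : Fin (N + 2)) (hi : (i : ℕ) < n) : inner ℝ (u' i) (J x) = 0 := by
    have := hg ⟨i, hi.trans_le hn⟩
    simpa [g, hi] using this
  have hx2 : 0 < ‖x‖ ^ 2 := by
    have := norm_pos_iff.2 hx0
    positivity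
  have h3 : q x ≤ l n * ‖x‖ ^ 2 := by
    rw [hu, ← u.sum_sq_norm_inner_right x, Finset.mul_sum]
    refine Finset.sum_le_sum fun i _ => ?_
    rw [Real.norm_eq_abs, sq_abs]
    rcases le_or_gt (i : ℕ) n with hi | hi
    · exact mul_le_mul_of_nonneg_right (hl hi) (sq_nonneg _)
    · rw [h1 i hi]; simp
  have h4 : l' n * ‖x‖ ^ 2 ≤ q x := by
    rw [← hq, hu', ← hJ, ← u'.sum_sq_norm_inner_right (J x), Finset.mul_sum]
    refine Finset.sum_le_sum fun i _ => ?_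
    rw [Real.norm_eq_abs, sq_abs]
    rcases lt_or_ge (i : ℕ) n with hi | hi
    · rw [h2 i hi]; simp
    · exact mul_le_mul_of_nonneg_right (hl' hi) (sq_nonneg _)
  exact le_of_mul_le_mul_right (h4.trans h3) hx2

/-! ### The eigenvalues of the Hankel matrices -/

theorem monotone_hankelEigenvalue (μ : Measure ℝ) (N : ℕ) : Monotone (hankelEigenvalue μ N) := by
  intro n m hnm
  refine (hankel_isHermitian μ N).eigenvalues₀_antitone ?_
  rw [Fin.mk_le_mk]
  omega

theorem exists_eigenbasis_hankel (μ : Measure ℝ) (N : ℕ) :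
    ∃ u : OrthonormalBasis (Fin (N + 1)) ℝ (EuclideanSpace ℝ (Fin (N + 1))),
      ∀ n : Fin (N + 1), Matrix.mulVec (hankel μ N) (u n).ofLp =
        hankelEigenvalue μ N n • (u n).ofLp := by
  let e : Fin (Fintype.card (Fin (N + 1))) ≃ Fin (N + 1) :=
    Fintype.equivOfCardEq (Fintype.card_fin _)
  -- `σ` undoes the enumeration built into `eigenvalues` and reverses the order, to list eigenvalues
  -- increasingly.
  let σ : Fin (N + 1) ≃ Fin (N + 1) :=
    (Fin.revPerm.trans (finCongr (Fintype.card_fin (N + 1)).symm)).trans e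
  refine ⟨(hankel_isHermitian μ N).eigenvectorBasis.reindex σ.symm, fun n => ?_⟩
  rw [OrthonormalBasis.reindex_apply, Equiv.symm_symm,
    (hankel_isHermitian μ N).mulVec_eigenvectorBasis]
  congr 1
  rw [Matrix.IsHermitian.eigenvalues, hankelEigenvalue]
  congr 1
  have : (Fintype.equivOfCardEq (Fintype.card_fin _)).symm (σ n) =
      finCongr (Fintype.card_fin (N + 1)).symm (Fin.revPerm n) := e.symm_apply_apply _
  rw [this]
  ext
  simp

theorem dotProduct_hankel_eq_sum (μ : Measure ℝ) (N : ℕ)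
    (u : OrthonormalBasis (Fin (N + 1)) ℝ (EuclideanSpace ℝ (Fin (N + 1))))
    (hu : ∀ n : Fin (N + 1), Matrix.mulVec (hankel μ N) (u n).ofLp =
        hankelEigenvalue μ N n • (u n).ofLp) (x : EuclideanSpace ℝ (Fin (N + 1))) :
    x.ofLp ⬝ᵥ Matrix.mulVec (hankel μ N) x.ofLp =
      ∑ i : Fin (N + 1), hankelEigenvalue μ N i * inner ℝ (u i) x ^ 2 := by
  have hx : x.ofLp = ∑ i, inner ℝ (u i) x • (u i).ofLp := by
    conv_lhs => rw [← u.sum_repr' x]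
    simp
  have h1 : Matrix.mulVec (hankel μ N) x.ofLp =
      ∑ i, (inner ℝ (u i) x * hankelEigenvalue μ N i) • (u i).ofLp := by
    conv_lhs => rw [hx]
    rw [Matrix.mulVec_sum]
    refine Finset.sum_congr rfl fun i _ => ?_
    rw [Matrix.mulVec_smul, hu, smul_smul]
  rw [h1, dotProduct_sum]
  refine Finset.sum_congr rfl fun i _ => ?_
  rw [dotProduct_smul]
  have : x.ofLp ⬝ᵥ (u i).ofLp = inner ℝ (u i) x := by
    simp [EuclideanSpace.inner_eq_star_dotProduct]
  rw [this, smul_eq_mul]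
  ring

theorem hankelEigenvalue_succ_le (μ : Measure ℝ) {N n : ℕ} (hn : n ≤ N) :
    hankelEigenvalue μ (N + 1) n ≤ hankelEigenvalue μ N n := by
  obtain ⟨u, hu⟩ := exists_eigenbasis_hankel μ N
  obtain ⟨u', hu'⟩ := exists_eigenbasis_hankel μ (N + 1)
  let J : EuclideanSpace ℝ (Fin (N + 1)) →ₗ[ℝ] EuclideanSpace ℝ (Fin (N + 2)) :=
    { toFun := fun x => WithLp.toLp 2 (Fin.snoc (α := fun _ => ℝ) x.ofLp 0)
      map_add' := fun x y => by
        ext i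
        refine Fin.lastCases ?_ (fun i => ?_) i <;> simp
      map_smul' := fun c x => by
        ext i
        refine Fin.lastCases ?_ (fun i => ?_) i <;> simp }
  have hJc (x : EuclideanSpace ℝ (Fin (N + 1))) (i : Fin (N + 1)) :
      (J x).ofLp i.castSucc = x.ofLp i := Fin.snoc_castSucc (α := fun _ => ℝ) _ _ _
  have hJl (x : EuclideanSpace ℝ (Fin (N + 1))) :
      (J x).ofLp (Fin.last (N + 1)) = 0 := Fin.snoc_last (α := fun _ => ℝ) _ _
  refine eigenvalue_le_of_isometry J (fun x => ?_)
    (q := fun x => x.ofLp ⬝ᵥ Matrix.mulVec (hankel μ N) x.ofLp)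
    (q' := fun x => x.ofLp ⬝ᵥ Matrix.mulVec (hankel μ (N + 1)) x.ofLp) (fun x => ?_) u u'
    (monotone_hankelEigenvalue μ N) (monotone_hankelEigenvalue μ (N + 1))
    (dotProduct_hankel_eq_sum μ N u hu) (dotProduct_hankel_eq_sum μ (N + 1) u' hu') hn
  · rw [EuclideanSpace.norm_eq, EuclideanSpace.norm_eq, Fin.sum_univ_castSucc]
    simp [hJc, hJl]
  · simp [dotProduct, Matrix.mulVec, Fin.sum_univ_castSucc, hJc, hJl, hankel]

/-! ### The inverse of the Hankel matrix -/

/-- The matrix whose columns are the coefficients of the orthonormal polynomials. -/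
noncomputable def orthCoeffMatrix (μ : Measure ℝ) (N : ℕ) :
    Matrix (Fin (N + 1)) (Fin (N + 1)) ℝ :=
  Matrix.of fun j m => (orthPoly μ m).coeff j

theorem polyInner_eq_sum {μ : Measure ℝ} (hμ : HasFiniteMoments μ) {p q : ℝ[X]} {N : ℕ}
    (hp : p.natDegree ≤ N) (hq : q.natDegree ≤ N) :
    polyInner μ p q = ∑ j : Fin (N + 1), ∑ k : Fin (N + 1),
      p.coeff j * moment μ (j + k) * q.coeff k := by
  have h (x : ℝ) : p.eval x * q.eval x = ∑ j : Fin (N + 1), ∑ k : Fin (N + 1),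
      p.coeff j * q.coeff k * x ^ ((j : ℕ) + k) := by
    rw [eval_eq_sum_range' (Nat.lt_succ_iff.2 hp), eval_eq_sum_range' (Nat.lt_succ_iff.2 hq),
      Finset.sum_range, Finset.sum_range, Finset.sum_mul_sum]
    exact Finset.sum_congr rfl fun j _ => Finset.sum_congr rfl fun k _ => by ring
  simp only [polyInner, h]
  rw [integral_finsetSum _ fun j _ => integrable_finsetSum _ fun k _ => (hμ _).const_mul _]
  refine Finset.sum_congr rfl fun j _ => ?_
  rw [integral_finsetSum _ fun k _ => (hμ _).const_mul _]
  refine Finset.sum_congr rfl fun k _ => ?_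
  rw [integral_const_mul, moment]
  ring

/-- Orthonormality reads `Bᵀ H B = 1`; for square matrices the factor `B` may be moved to the front,
so `B Bᵀ` is the inverse of `H`. -/
theorem orthCoeffMatrix_mul_transpose_mul_hankel {μ : Measure ℝ} (hμ : HasFiniteMoments μ)
    (hsupp : μ.support.Infinite) (N : ℕ) :
    orthCoeffMatrix μ N * ((orthCoeffMatrix μ N).transpose * hankel μ N) = 1 := by
  rw [mul_eq_one_comm]
  ext n m
  have hdeg (i : Fin (N + 1)) : (orthPoly μ i).natDegree ≤ N := by
    rw [((orthPoly_spec hμ hsupp).1 i).1]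
    omega
  have h1 := (orthPoly_spec hμ hsupp).2 n m
  have h2 := polyInner_eq_sum hμ (hdeg n) (hdeg m)
  rw [polyInner, h1] at h2
  rw [Matrix.one_apply]
  simp only [Fin.ext_iff]
  rw [h2, Matrix.mul_apply, Finset.sum_comm]
  refine Finset.sum_congr rfl fun j _ => ?_
  rw [Matrix.mul_apply, Finset.sum_mul]
  rfl

theorem hankelEigenvalue_smul_mulVec {μ : Measure ℝ} (hμ : HasFiniteMoments μ)
    (hsupp : μ.support.Infinite) {N : ℕ} {n : ℕ} {v : Fin (N + 1) → ℝ}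
    (hv : Matrix.mulVec (hankel μ N) v = hankelEigenvalue μ N n • v) :
    hankelEigenvalue μ N n • Matrix.mulVec (orthCoeffMatrix μ N)
      (Matrix.mulVec (orthCoeffMatrix μ N).transpose v) = v := by
  have := congrArg (fun M => Matrix.mulVec M v)
    (orthCoeffMatrix_mul_transpose_mul_hankel hμ hsupp N)
  simp only [← Matrix.mulVec_mulVec, Matrix.one_mulVec, hv, Matrix.mulVec_smul] at this
  exact this

theorem hankelEigenvalue_mul_sum_sq {μ : Measure ℝ} (hμ : HasFiniteMoments μ)
    (hsupp : μ.support.Infinite) {N : ℕ} {n : ℕ} {v : Fin (N + 1) → ℝ}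
    (hv : Matrix.mulVec (hankel μ N) v = hankelEigenvalue μ N n • v) :
    hankelEigenvalue μ N n * ∑ m, (Matrix.mulVec (orthCoeffMatrix μ N).transpose v m) ^ 2 =
      v ⬝ᵥ v := by
  have h := congrArg (fun w => v ⬝ᵥ w) (hankelEigenvalue_smul_mulVec hμ hsupp hv)
  simp only [dotProduct_smul, smul_eq_mul] at h
  rw [← h, Matrix.dotProduct_mulVec, ← Matrix.mulVec_transpose]
  simp [dotProduct, sq]

theorem hankelEigenvalue_pos {μ : Measure ℝ} (hμ : HasFiniteMoments μ)
    (hsupp : μ.support.Infinite) {N n : ℕ} (hn : n ≤ N) : 0 < hankelEigenvalue μ N n := by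
  obtain ⟨u, hu⟩ := exists_eigenbasis_hankel μ N
  have h := hankelEigenvalue_mul_sum_sq hμ hsupp (hu ⟨n, Nat.lt_succ_iff.2 hn⟩)
  have h1 : (u ⟨n, Nat.lt_succ_iff.2 hn⟩).ofLp ⬝ᵥ (u ⟨n, Nat.lt_succ_iff.2 hn⟩).ofLp = 1 := by
    have := u.inner_eq_one ⟨n, Nat.lt_succ_iff.2 hn⟩
    rwa [EuclideanSpace.inner_eq_star_dotProduct, star_trivial] at this
  rw [h1] at h
  refine pos_of_mul_pos_left (b := ∑ m, _) (h ▸ one_pos) (Finset.sum_nonneg fun m _ => sq_nonneg _)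

/-- Both sides are the trace of `H⁻¹ = B Bᵀ`: each `1 / λ` equals `‖Bᵀ u‖²` for its unit eigenvector
`u`, and Parseval sums these over the basis. -/
theorem sum_inv_hankelEigenvalue {μ : Measure ℝ} (hμ : HasFiniteMoments μ)
    (hsupp : μ.support.Infinite) (N : ℕ) :
    ∑ n : Fin (N + 1), (hankelEigenvalue μ N n)⁻¹ =
      ∑ m : Fin (N + 1), ∑ j : Fin (N + 1), (orthPoly μ m).coeff j ^ 2 := by
  obtain ⟨u, hu⟩ := exists_eigenbasis_hankel μ N
  set b : Fin (N + 1) → EuclideanSpace ℝ (Fin (N + 1)) :=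
    fun m => WithLp.toLp 2 fun j => (orthPoly μ m).coeff j
  have h1 (n : Fin (N + 1)) : (hankelEigenvalue μ N n)⁻¹ = ∑ m, inner ℝ (u n) (b m) ^ 2 := by
    have h := hankelEigenvalue_mul_sum_sq hμ hsupp (hu n)
    have h2 : (u n).ofLp ⬝ᵥ (u n).ofLp = 1 := by
      have := u.inner_eq_one n
      rwa [EuclideanSpace.inner_eq_star_dotProduct, star_trivial] at this
    rw [h2] at h
    rw [inv_eq_of_mul_eq_one_right h]
    refine Finset.sum_congr rfl fun m _ => ?_
    congr 1
  simp only [h1]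
  rw [Finset.sum_comm]
  refine Finset.sum_congr rfl fun m _ => ?_
  have h3 := u.sum_sq_norm_inner_right (b m)
  rw [EuclideanSpace.norm_sq_eq] at h3
  simpa [b] using h3

/-! ### The operator on `ℓ²` -/

/-- A real vector with finitely many coordinates as an element of `ℓ²`. -/
noncomputable def finEmbed {M : ℕ} (x : Fin M → ℝ) : EllTwo :=
  ∑ j : Fin M, lp.single 2 (j : ℕ) (x j : ℂ)

theorem finEmbed_apply {M : ℕ} (x : Fin M → ℝ) (k : ℕ) :
    finEmbed x k = if h : k < M then (x ⟨k, h⟩ : ℂ) else 0 := by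
  rw [finEmbed, lp.coeFn_sum, Finset.sum_apply]
  split_ifs with h
  · rw [Finset.sum_eq_single ⟨k, h⟩]
    · simp
    · intro j _ hj
      have : k ≠ j := fun h0 => hj (Fin.ext h0.symm)
      simp [this]
    · simp
  · refine Finset.sum_eq_zero fun j _ => ?_
    have : k ≠ j := fun h0 => h (h0 ▸ j.2)
    simp [this]

theorem ellTwo_smul_apply (c : ℂ) (f : EllTwo) (k : ℕ) : (c • f) k = c * f k := rfl

theorem finEmbed_sum_smul {M : ℕ} {ι : Type*} [Fintype ι] (c : ι → ℝ) (f : ι → Fin M → ℝ) :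
    finEmbed (∑ i, c i • f i) = ∑ i, (c i : ℂ) • finEmbed (f i) := by
  ext k
  rw [lp.coeFn_sum, Finset.sum_apply, finEmbed_apply]
  split_ifs with h
  · simp only [ellTwo_smul_apply, finEmbed_apply, dif_pos h, Finset.sum_apply]
    simp
  · simp only [ellTwo_smul_apply, finEmbed_apply, dif_neg h, mul_zero, Finset.sum_const_zero]

theorem finEmbed_smul {M : ℕ} (c : ℝ) (x : Fin M → ℝ) :
    finEmbed (c • x) = (c : ℂ) • finEmbed x := by
  simpa using finEmbed_sum_smul (fun _ : Unit => c) (fun _ => x)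

theorem inner_finEmbed {M : ℕ} (x y : Fin M → ℝ) :
    inner ℂ (finEmbed x) (finEmbed y) = ((x ⬝ᵥ y : ℝ) : ℂ) := by
  conv_lhs => rw [finEmbed]
  rw [sum_inner, dotProduct, Complex.ofReal_sum]
  refine Finset.sum_congr rfl fun j _ => ?_
  rw [lp.inner_single_left, finEmbed_apply, dif_pos j.2]
  simp [mul_comm]

/-- The coefficients of the `n`-th orthonormal polynomial as an element of `ℓ²`. -/
noncomputable def orthCoeffVec (μ : Measure ℝ) (n : ℕ) : EllTwo :=
  finEmbed fun j : Fin (n + 1) => (orthPoly μ n).coeff j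

theorem coeff_cOrthPoly (μ : Measure ℝ) (n j : ℕ) :
    (cOrthPoly μ n).coeff j = (((orthPoly μ n).coeff j : ℝ) : ℂ) := coeff_map _ _

theorem finEmbed_coeff_apply {μ : Measure ℝ} (hμ : HasFiniteMoments μ)
    (hsupp : μ.support.Infinite) {n N : ℕ} (hn : n ≤ N) (k : ℕ) :
    finEmbed (fun j : Fin (N + 1) => (orthPoly μ n).coeff j) k = (cOrthPoly μ n).coeff k := by
  rw [finEmbed_apply, coeff_cOrthPoly]
  split_ifs with h
  · rfl
  · rw [coeff_eq_zero_of_natDegree_lt, Complex.ofReal_zero]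
    rw [((orthPoly_spec hμ hsupp).1 n).1]
    omega

theorem orthCoeffVec_apply {μ : Measure ℝ} (hμ : HasFiniteMoments μ)
    (hsupp : μ.support.Infinite) (n k : ℕ) : orthCoeffVec μ n k = (cOrthPoly μ n).coeff k :=
  finEmbed_coeff_apply hμ hsupp le_rfl k

theorem orthCoeffVec_eq_finEmbed {μ : Measure ℝ} (hμ : HasFiniteMoments μ)
    (hsupp : μ.support.Infinite) {n N : ℕ} (hn : n ≤ N) :
    orthCoeffVec μ n = finEmbed fun j : Fin (N + 1) => (orthPoly μ n).coeff j := by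
  ext k
  rw [orthCoeffVec_apply hμ hsupp, finEmbed_coeff_apply hμ hsupp hn]

theorem norm_orthCoeffVec_le {μ : Measure ℝ} (hμ : HasFiniteMoments μ)
    (hsupp : μ.support.Infinite) (n : ℕ) :
    ‖orthCoeffVec μ n‖ ≤ weightedNorm 1 (cOrthPoly μ n) := by
  have h := lp.hasSum_single (E := fun _ : ℕ => ℂ) (p := 2) (by simp) (orthCoeffVec μ n)
  have hs := summable_coeff_mul_pow 1 (cOrthPoly μ n)
  have heq (j : ℕ) : ‖lp.single (E := fun _ : ℕ => ℂ) 2 j (orthCoeffVec μ n j)‖ =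
      ‖(cOrthPoly μ n).coeff j‖ * 1 ^ j := by
    rw [lp.norm_single (by simp), orthCoeffVec_apply hμ hsupp, one_pow, mul_one]
  rw [← h.tsum_eq, weightedNorm]
  simp only [← heq] at hs ⊢
  exact norm_tsum_le_tsum_norm hs

theorem summable_norm_sq_orthCoeffVec {μ : Measure ℝ} (hμ : HasFiniteMoments μ)
    (hsupp : μ.support.Infinite) (hindet : IsIndeterminate μ) :
    Summable fun n => ‖orthCoeffVec μ n‖ ^ 2 :=
  Summable.of_nonneg_of_le (fun n => by positivity)
    (fun n => pow_le_pow_left₀ (norm_nonneg _) (norm_orthCoeffVec_le hμ hsupp n) 2)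
    (summable_weightedNorm_sq hμ hsupp hindet zero_le_one)

theorem norm_sq_orthCoeffVec {μ : Measure ℝ} (hμ : HasFiniteMoments μ)
    (hsupp : μ.support.Infinite) {n N : ℕ} (hn : n ≤ N) :
    ‖orthCoeffVec μ n‖ ^ 2 = ∑ j : Fin (N + 1), (orthPoly μ n).coeff j ^ 2 := by
  have h := inner_self_eq_norm_sq_to_K (𝕜 := ℂ) (orthCoeffVec μ n)
  rw [orthCoeffVec_eq_finEmbed hμ hsupp hn, inner_finEmbed] at h
  rw [orthCoeffVec_eq_finEmbed hμ hsupp hn]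
  have h2 : (fun j : Fin (N + 1) => (orthPoly μ n).coeff j) ⬝ᵥ
      (fun j : Fin (N + 1) => (orthPoly μ n).coeff j) =
      ∑ j : Fin (N + 1), (orthPoly μ n).coeff j ^ 2 := by
    simp [dotProduct, sq]
  rw [← h2]
  exact Complex.ofReal_injective (by simpa using h.symm)

theorem hasMatrix_frameOp {μ : Measure ℝ} (hμ : HasFiniteMoments μ)
    (hsupp : μ.support.Infinite) (hindet : IsIndeterminate μ) :
    HasMatrix (frameOp (orthCoeffVec μ)) (kernelCoeff μ) := by
  intro j k
  rw [kernelCoeff_eq_tsum hμ hsupp hindet]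
  have hcoord (f : EllTwo) : inner ℂ (lp.single 2 j (1 : ℂ) : EllTwo) f = f j := by
    rw [lp.inner_single_left]
    simp
  have h := (hasSum_frameOp_apply (summable_norm_sq_orthCoeffVec hμ hsupp hindet)
    (lp.single 2 k (1 : ℂ))).mapL (innerSL ℂ (lp.single 2 j (1 : ℂ) : EllTwo))
  simp only [innerSL_apply_apply, hcoord, ellTwo_smul_apply] at h
  rw [← h.tsum_eq]
  refine tsum_congr fun n => ?_
  -- The coefficients are real, so the conjugate in the inner product disappears and the kernel's
  -- bilinear coefficients result.
  rw [lp.inner_single_right, orthCoeffVec_apply hμ hsupp, orthCoeffVec_apply hμ hsupp,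
    coeff_cOrthPoly, coeff_cOrthPoly]
  simp [mul_comm]

theorem frameOpTrunc_finEmbed {μ : Measure ℝ} (hμ : HasFiniteMoments μ)
    (hsupp : μ.support.Infinite) (N : ℕ) (v : Fin (N + 1) → ℝ) :
    frameOpTrunc (orthCoeffVec μ) N (finEmbed v) =
      finEmbed (Matrix.mulVec (orthCoeffMatrix μ N)
        (Matrix.mulVec (orthCoeffMatrix μ N).transpose v)) := by
  have h : Matrix.mulVec (orthCoeffMatrix μ N)
        (Matrix.mulVec (orthCoeffMatrix μ N).transpose v) =
      ∑ m : Fin (N + 1), Matrix.mulVec (orthCoeffMatrix μ N).transpose v m •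
        fun j : Fin (N + 1) => (orthPoly μ m).coeff j := by
    ext j
    rw [Matrix.mulVec, dotProduct, Finset.sum_apply]
    exact Finset.sum_congr rfl fun m _ => mul_comm _ _
  rw [h, finEmbed_sum_smul, frameOpTrunc_apply, Finset.sum_range]
  refine Finset.sum_congr rfl fun m _ => ?_
  rw [orthCoeffVec_eq_finEmbed hμ hsupp (Nat.lt_succ_iff.1 m.2), inner_finEmbed]
  rfl

/-- The reciprocals decrease in `n`, so `n + 1` copies of the `n`-th are at most the trace of `H⁻¹`,
a partial sum of `∑ ‖b m‖²`. The bound does not depend on `N`: it keeps the limits positive and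
gives the decay needed for the spectrum. -/
theorem add_one_mul_inv_hankelEigenvalue_le {μ : Measure ℝ} (hμ : HasFiniteMoments μ)
    (hsupp : μ.support.Infinite) (hindet : IsIndeterminate μ) {N n : ℕ} (hn : n ≤ N) :
    (n + 1) * (hankelEigenvalue μ N n)⁻¹ ≤ ∑' m, ‖orthCoeffVec μ m‖ ^ 2 := by
  have h1 : ∑ i ∈ Finset.range (N + 1), (hankelEigenvalue μ N i)⁻¹ ≤
      ∑' m, ‖orthCoeffVec μ m‖ ^ 2 := by
    rw [Finset.sum_range, sum_inv_hankelEigenvalue hμ hsupp]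
    refine le_trans (le_of_eq ?_) ((summable_norm_sq_orthCoeffVec hμ hsupp hindet).sum_le_tsum
      (Finset.range (N + 1)) fun _ _ => by positivity)
    rw [Finset.sum_range]
    exact Finset.sum_congr rfl fun m _ =>
      (norm_sq_orthCoeffVec hμ hsupp (Nat.lt_succ_iff.1 m.2)).symm
  have h2 : ∑ i ∈ Finset.range (n + 1), (hankelEigenvalue μ N i)⁻¹ ≤
      ∑ i ∈ Finset.range (N + 1), (hankelEigenvalue μ N i)⁻¹ := by
    refine Finset.sum_le_sum_of_subset_of_nonneg
      (Finset.range_subset_range.2 (Nat.succ_le_succ hn)) fun i hi _ => ?_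
    exact inv_nonneg.2 (hankelEigenvalue_pos hμ hsupp
      (Nat.lt_succ_iff.1 (Finset.mem_range.1 hi))).le
  have h3 := Finset.card_nsmul_le_sum (Finset.range (n + 1))
    (fun i => (hankelEigenvalue μ N i)⁻¹) (hankelEigenvalue μ N n)⁻¹ fun i hi => by
      have hin := Nat.lt_succ_iff.1 (Finset.mem_range.1 hi)
      exact inv_anti₀ (hankelEigenvalue_pos hμ hsupp (hin.trans hn))
        (monotone_hankelEigenvalue μ N hin)
  rw [Finset.card_range, nsmul_eq_mul, Nat.cast_add, Nat.cast_one] at h3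
  exact h3.trans (h2.trans h1)

theorem tsum_norm_sq_orthCoeffVec_pos {μ : Measure ℝ} (hμ : HasFiniteMoments μ)
    (hsupp : μ.support.Infinite) (hindet : IsIndeterminate μ) :
    0 < ∑' m, ‖orthCoeffVec μ m‖ ^ 2 := by
  refine lt_of_lt_of_le ?_ (add_one_mul_inv_hankelEigenvalue_le hμ hsupp hindet (le_refl 0))
  have := hankelEigenvalue_pos hμ hsupp (le_refl 0)
  positivity

theorem tendsto_hankelEigenvalue {μ : Measure ℝ} (hμ : HasFiniteMoments μ)
    (hsupp : μ.support.Infinite) (hindet : IsIndeterminate μ) (n : ℕ) :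
    Tendsto (fun N : ℕ => hankelEigenvalue μ N n) atTop (𝓝 (limitEigenvalue μ n)) ∧
      0 < limitEigenvalue μ n := by
  set K := ∑' m, ‖orthCoeffVec μ m‖ ^ 2
  have hK : 0 < K := tsum_norm_sq_orthCoeffVec_pos hμ hsupp hindet
  -- The shift by `n` skips the orders `N < n`, where the value is meaningless.
  have hanti : Antitone fun N => hankelEigenvalue μ (N + n) n := by
    refine antitone_nat_of_succ_le fun N => ?_
    rw [Nat.add_right_comm]
    exact hankelEigenvalue_succ_le μ (Nat.le_add_left n N)
  have hlow (N : ℕ) : ((n : ℝ) + 1) / K ≤ hankelEigenvalue μ (N + n) n := by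
    have h := add_one_mul_inv_hankelEigenvalue_le hμ hsupp hindet (Nat.le_add_left n N)
    have hpos := hankelEigenvalue_pos hμ hsupp (Nat.le_add_left n N)
    rw [← div_eq_mul_inv, div_le_iff₀ hpos] at h
    rw [div_le_iff₀ hK]
    linarith
  have hbdd : BddBelow (Set.range fun N => hankelEigenvalue μ (N + n) n) :=
    ⟨_, by rintro _ ⟨N, rfl⟩; exact hlow N⟩
  have hlim := (tendsto_add_atTop_iff_nat (f := fun N => hankelEigenvalue μ N n) n).1
    (tendsto_atTop_ciInf hanti hbdd)
  have heq : limitEigenvalue μ n = _ := hlim.limUnder_eq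
  rw [heq]
  exact ⟨hlim, lt_of_lt_of_le (by positivity) (le_ciInf hlow)⟩

theorem spectrum_frameOp_orthCoeffVec {μ : Measure ℝ} (hμ : HasFiniteMoments μ)
    (hsupp : μ.support.Infinite) (hindet : IsIndeterminate μ) :
    spectrum ℂ (frameOp (orthCoeffVec μ)) =
      {0} ∪ Set.range (fun n : ℕ => (((limitEigenvalue μ n)⁻¹ : ℝ) : ℂ)) := by
  choose u hu using exists_eigenbasis_hankel μ
  refine spectrum_frameOp (summable_norm_sq_orthCoeffVec hμ hsupp hindet)
    (e := fun N i => finEmbed (u N i).ofLp) (s := fun N n => (hankelEigenvalue μ N n)⁻¹)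
    (fun N => ?_) (fun N i => ?_) (fun N m hm => ?_)
    (tsum_norm_sq_orthCoeffVec_pos hμ hsupp hindet) (fun N n hn => ?_) (fun n => ?_)
  · rw [orthonormal_iff_ite]
    intro i j
    have := orthonormal_iff_ite.1 (u N).orthonormal i j
    rw [EuclideanSpace.inner_eq_star_dotProduct, star_trivial, dotProduct_comm] at this
    rw [inner_finEmbed, this]
    split_ifs <;> simp
  · have hpos := hankelEigenvalue_pos hμ hsupp (Nat.lt_succ_iff.1 i.2)
    rw [frameOpTrunc_finEmbed hμ hsupp, ← finEmbed_smul]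
    congr 1
    rw [eq_inv_smul_iff₀ hpos.ne']
    exact hankelEigenvalue_smul_mulVec hμ hsupp (hu N i)
  -- For `m ≤ N` the vector `b m` lives on the first `N + 1` coordinates, which the Hankel
  -- eigenvectors span.
  · set x : EuclideanSpace ℝ (Fin (N + 1)) := WithLp.toLp 2 fun j => (orthPoly μ m).coeff j
    have hx : (fun j : Fin (N + 1) => (orthPoly μ m).coeff j) =
        ∑ i, inner ℝ (u N i) x • (u N i).ofLp := by
      change x.ofLp = _
      conv_lhs => rw [← (u N).sum_repr' x]
      simp
    rw [orthCoeffVec_eq_finEmbed hμ hsupp hm, hx, finEmbed_sum_smul]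
    exact Submodule.sum_mem _ fun i _ =>
      Submodule.smul_mem _ _ (Submodule.subset_span (Set.mem_range_self i))
  · rw [abs_of_pos (inv_pos.2 (hankelEigenvalue_pos hμ hsupp hn)), le_div_iff₀' (by positivity)]
    exact add_one_mul_inv_hankelEigenvalue_le hμ hsupp hindet hn
  · have h := tendsto_hankelEigenvalue hμ hsupp hindet n
    exact h.1.inv₀ h.2.ne'

theorem theorem4p5 (μ : Measure ℝ) (hmom : HasFiniteMoments μ) (hsupp : μ.support.Infinite)
    (hindet : IsIndeterminate μ) :
    -- the kernel and its coefficients are well defined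
    (∀ z : ℂ, Summable fun n : ℕ => ‖aeval z (orthPoly μ n)‖ ^ 2) ∧
    (∀ z w : ℂ, HasSum (fun p : ℕ × ℕ => kernelCoeff μ p.1 p.2 * z ^ p.1 * w ^ p.2)
      (kernelK μ z w)) ∧
    -- the limits of the eigenvalues of the Hankel matrices exist and are positive
    (∀ n : ℕ, Tendsto (fun N : ℕ => hankelEigenvalue μ N n) atTop (𝓝 (limitEigenvalue μ n)) ∧
      0 < limitEigenvalue μ n) ∧
    -- the matrix of coefficients is that of a positive trace class operator with given spectrum
    ∃ A : EllTwo →L[ℂ] EllTwo, HasMatrix A (kernelCoeff μ) ∧ IsTraceClass A ∧ A.IsPositive ∧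
      spectrum ℂ A = {0} ∪ Set.range (fun n : ℕ => (((limitEigenvalue μ n)⁻¹ : ℝ) : ℂ)) := by
  have hb := summable_norm_sq_orthCoeffVec hmom hsupp hindet
  refine ⟨summable_norm_sq_aeval hmom hsupp hindet, fun z w => ?_,
    tendsto_hankelEigenvalue hmom hsupp hindet, frameOp (orthCoeffVec μ),
    hasMatrix_frameOp hmom hsupp hindet, isTraceClass_frameOp hb, isPositive_frameOp hb,
    spectrum_frameOp_orthCoeffVec hmom hsupp hindet⟩
  simpa only [kernelCoeff_eq_tsum hmom hsupp hindet] using hasSum_kernelK hmom hsupp hindet z w
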